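/- Fix an integer base $b\ge 2$ and let $f:[0,1]\to\mathbb{R}$ be differentiable with derivative that is Lipschitz continuous of order $\beta>0$, i.e. $|f'(x)-f'(y)|\le C|x-y|^{\beta}$ on $[0,1]$ for some constant $C$. Put $$I(f)=\int_0^1 f(x)\,dx,\qquad \sigma^2(f)=\frac1{12}\int_0^1 f'(x)^2\,dx .$$ For $N=b^m$ let $Q_N=\frac1N\sum_{i=0}^{N-1} f(X_{N,i})$, where the random points $X_{N,0},\dots,X_{N,N-1}$ are either obtained by fully nested scrambling in base $b$ of a $(0,m,1)$-net (a set of $b^m$ points of $[0,1)$ with exactly one point in each interval $[j/b^m,(j+1)/b^m)$), or given by jittered sampling ($X_{N,i}$ independent, uniform on $[i/N,(i+1)/N]$). Here fully nested scrambling maps $a=\sum_{k\ge1}\alpha_k b^{-k}\in[0,1)$ to $\sum_{k\ge 1}\pi_{\alpha_1\cdots\alpha_{k-1}}(\alpha_k)\,b^{-k}$, where the permutations $\pi_{\alpha_1\cdots\alpha_{k-1}}$ of $\{0,\dots,b-1\}$, one for each finite string of digits, are independent and uniformly distributed over all $b!$ permutations. For $r\ge1$ let $M_N^{(r)}$ be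 the sample median (the midpoint of the two middle values if $r$ is even) of $r$ independent copies of $Q_N$ (computed from $r$ independent sets of random points). Then $$\sqrt r\,N^{3/2}\bigl(M_N^{(r)}-I(f)\bigr)\ \xrightarrow{d}\ \mathcal N\!\left(0,\frac{\pi\,\sigma^2(f)}{2}\right)\qquad(N\to\infty\text{ and then }r\to\infty),$$ that is, for every fixed $r\ge 1$ the left-hand side converges in law, as $m\to\infty$ (so $N=b^m\to\infty$), to some probability measure $\nu_r$ on $\mathbb{R}$, and $\nu_r$ converges weakly to $\mathcal N(0,\pi\sigma^2(f)/2)$ as $r\to\infty$ (where $\mathcal N(0,0)$ denotes the point mass at $0$). In particular the median estimator does not improve the rate $N^{-3/2}$: if $\sigma^2(f)>0$, then for every fixed $r\ge1$ and every real sequence $\delta_m\to0$, $$\mathbb{P}\bigl(|M_N^{(r)}-I(f)|>\delta_m N^{-3/2}\bigr)\to1\qquad(m\to\infty,\ N=b^m).$$ -/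

import Mathlib

open MeasureTheory ProbabilityTheory Filter Topology
open scoped NNReal

namespace MedianRQMC

noncomputable section

/-- `f` is differentiable on `[0,1]` (one-sidedly at the end points) and its derivative is
Lipschitz of order `β`: `|f' x - f' y| ≤ C |x - y| ^ β` on `[0,1]`, for some constant `C`. -/
def LipschitzDerivative (β : ℝ≥0) (f : ℝ → ℝ) : Prop :=
  DifferentiableOn ℝ f (Set.Icc 0 1) ∧
    ∃ C : ℝ≥0, HolderOnWith C β (derivWithin f (Set.Icc 0 1)) (Set.Icc 0 1)

/-- `I(f) = ∫₀¹ f(x) dx`. -/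
def exactIntegral (f : ℝ → ℝ) : ℝ := ∫ x in (0 : ℝ)..1, f x

/-- `σ²(f) = (1/12) ∫₀¹ f'(x)² dx`. -/
def sigmaSq (f : ℝ → ℝ) : ℝ :=
  (1 / 12) * ∫ x in (0 : ℝ)..1, (derivWithin f (Set.Icc 0 1) x) ^ 2

/-- The equal-weight quadrature rule `(1/N) ∑ᵢ f(xᵢ)`. -/
def quadrature (f : ℝ → ℝ) {N : ℕ} (x : Fin N → ℝ) : ℝ := (1 / (N : ℝ)) * ∑ i, f (x i)

/-- The sample median of `r` numbers: the middle one in increasing order if `r` is odd, the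
midpoint of the two middle ones if `r` is even (and `0` if `r = 0`). -/
def sampleMedian {r : ℕ} (v : Fin r → ℝ) : ℝ :=
  if h : 0 < r then
    (v (Tuple.sort v ⟨(r - 1) / 2, by omega⟩) + v (Tuple.sort v ⟨r / 2, by omega⟩)) / 2
  else 0

/-- Jittered sampling with `N` strata: the points are independent, the `i`-th one being uniform
on `[i/N, (i+1)/N]`. -/
structure IsJitteredSample {Ω : Type*} [MeasurableSpace Ω] (P : Measure Ω) {N : ℕ}
    (X : Fin N → Ω → ℝ) : Prop where
  indep : iIndepFun X P
  uniform : ∀ i : Fin N,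
    pdf.IsUniform (X i) (Set.Icc ((i : ℝ) / N) (((i : ℝ) + 1) / N)) P volume

/-- A `(0,m,1)`-net in base `b`: `b ^ m` points of `[0,1)`, exactly one of them in each interval
`[j/b^m, (j+1)/b^m)`. -/
def IsNet (b m : ℕ) (a : Fin (b ^ m) → ℝ) : Prop :=
  (∀ i, a i ∈ Set.Ico (0 : ℝ) 1) ∧
    ∀ j : Fin (b ^ m), ∃! i, a i ∈ Set.Ico ((j : ℝ) / (b : ℝ) ^ m) (((j : ℝ) + 1) / (b : ℝ) ^ m)

/-- A family of permutations of the digits `{0, …, b-1}`, one for each finite string of digits,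
that are independent and uniformly distributed on all `b!` permutations. -/
structure IsUniformPermTree {Ω : Type*} [MeasurableSpace Ω] (P : Measure Ω) {b : ℕ}
    (p : List (Fin b) → Ω → Equiv.Perm (Fin b)) : Prop where
  meas : ∀ l s, MeasurableSet (p l ⁻¹' {s})
  indep : iIndepFun (m := fun _ => ⊤) p P
  uniform : ∀ l s, P (p l ⁻¹' {s}) = ((b.factorial : ENNReal))⁻¹

/-- Nested scrambling of a point `a ∈ [0,1)` with base-`b` digits `α₁, α₂, …`: the point with
digits `ξₖ = p_{α₁ … αₖ₋₁}(αₖ)`. (The digits are indexed from `0` below.) -/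
def nestedScramble {b : ℕ} [NeZero b] (p : List (Fin b) → Equiv.Perm (Fin b)) (a : ℝ) : ℝ :=
  Real.ofDigits fun k : ℕ =>
    p (List.ofFn fun i : Fin k => Real.digits a b i) (Real.digits a b k)

/-- The random points `X` are obtained by fully nested scrambling of a `(0,m,1)`-net in base
`b`. -/
def IsNestedScrambledNet {Ω : Type*} [MeasurableSpace Ω] (P : Measure Ω) (b m : ℕ) [NeZero b]
    (X : Fin (b ^ m) → Ω → ℝ) : Prop :=
  ∃ a : Fin (b ^ m) → ℝ, IsNet b m a ∧
    ∃ p : List (Fin b) → Ω → Equiv.Perm (Fin b), IsUniformPermTree P p ∧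
      ∀ i ω, X i ω = nestedScramble (fun l => p l ω) (a i)

/-- The median estimator `median (Q⁽¹⁾, …, Q⁽ʳ⁾)`, where `Q⁽ʲ⁾` is the quadrature rule with the
nodes `X j`. -/
def medianEstimator (f : ℝ → ℝ) {Ω : Type*} {r N : ℕ} (X : Fin r → Fin N → Ω → ℝ) (ω : Ω) : ℝ :=
  sampleMedian fun j => quadrature f fun i => X j i ω

end

end MedianRQMC

/-! Both sampling schemes satisfy the same identity: for bounded continuous `g`, the expectation of
the product of `g` over all nodes is the product over the `N` strata of the mean of `g` on the
stratum. For jittered sampling this is independence. For a scrambled net it says that, up to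
labelling, the nodes are independent and uniform, one per stratum: scrambling permutes the first `m`
digits among all strata, and every later digit is uniform and independent across points, because the
points already have different prefixes.

Taking `g = exp(i s F)` factorises the characteristic function of the normalised error. On a stratum
of length `δ = 1/N` the integrand is affine up to `O(δ^(1+β))`, so its centred value divided by `δ`
is bounded and has variance `f'(s)²/12 + O(δ^β)`. The variances average to `σ²(f)`, and a central
limit theorem for bounded triangular arrays (`tendsto_prod_integral_exp`) gives `N^(3/2) (Q_N - I) →
N(0, σ²)`, see `tendsto_law_scaledError`.

The median is a continuous map commuting with increasing affine maps. Hence for fixed `r` the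
normalised median converges to `√r` times the median of `r` independent `N(0, σ²)` variables
(`tendstoInDistribution_median`). As `r → ∞`, the event that an order statistic is at most `x/√r` is
an event about the number of samples below `x/√r`; the same central limit theorem applies to this
count, and the Gaussian density `1/√(2π)` at `0` produces the variance `πσ²/2`
(`tendsto_gaussianMedianLaw`).

The lower bound on the rate holds because the limit law for fixed `r` has no atom at `0` when `σ² >
0`. -/

namespace MedianRQMC

/-! ### Order statistics and the sample median -/

section OrderStatistics

variable {r : ℕ}

/-- The `k`-th smallest (counting from `0`) of `r` real numbers. -/
noncomputable def orderStat (v : Fin r → ℝ) (k : Fin r) : ℝ := v (Tuple.sort v k)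

/-- Sorting does not change how many coordinates lie below `x`. The equivalence turns order
statistics into sums of indicators, to which a central limit theorem applies. -/
theorem orderStat_le_iff (v : Fin r → ℝ) (k : Fin r) (x : ℝ) :
    orderStat v k ≤ x ↔ (k : ℕ) < (Finset.univ.filter fun i => v i ≤ x).card := by
  have h := Tuple.lt_card_le_iff_apply_le_of_monotone (f := v ∘ Tuple.sort v) (j := k) (a := x)
    (Tuple.monotone_sort v)
  have hc : (Finset.univ.filter fun i => (v ∘ Tuple.sort v) i ≤ x).card =
      (Finset.univ.filter fun i => v i ≤ x).card := by
    rw [← Fintype.card_subtype, ← Fintype.card_subtype]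
    exact Fintype.card_congr ((Tuple.sort v).subtypeEquiv fun _ => Iff.rfl)
  rw [hc] at h
  exact h.symm

theorem orderStat_mono (v : Fin r → ℝ) : Monotone (orderStat v) := Tuple.monotone_sort v

/-- The permutation sorting `v` also makes the affine image monotone, and any two monotone
rearrangements coincide. -/
theorem orderStat_affine (v : Fin r → ℝ) {c : ℝ} (hc : 0 ≤ c) (d : ℝ) (k : Fin r) :
    orderStat (fun j => c * v j + d) k = c * orderStat v k + d := by
  have h1 : Monotone ((fun j => c * v j + d) ∘ Tuple.sort v) := fun i j hij => by
    have := Tuple.monotone_sort v hij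
    simp only [Function.comp_apply] at this ⊢
    gcongr
  exact (congrFun (Tuple.unique_monotone h1 (Tuple.monotone_sort fun j => c * v j + d)) k).symm

/-- Every index counted for `w` at level `orderStat w k` is counted for `v` at that level plus `ε`.
Used in both directions, this makes each order statistic 1-Lipschitz for the sup distance. -/
theorem orderStat_le_add {v w : Fin r → ℝ} {ε : ℝ} (h : ∀ i, v i ≤ w i + ε) (k : Fin r) :
    orderStat v k ≤ orderStat w k + ε := by
  rw [orderStat_le_iff]
  refine ((orderStat_le_iff w k (orderStat w k)).1 le_rfl).trans_le (Finset.card_le_card ?_)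
  intro i hi
  simp only [Finset.mem_filter, Finset.mem_univ, true_and] at hi ⊢
  linarith [h i]

theorem continuous_orderStat (k : Fin r) : Continuous fun v : Fin r → ℝ => orderStat v k := by
  refine LipschitzWith.continuous (K := 1) (LipschitzWith.of_dist_le_mul fun v w => ?_)
  have hd : ∀ i, |v i - w i| ≤ dist v w := fun i => by
    rw [← Real.dist_eq]; exact dist_le_pi_dist v w i
  have h1 := orderStat_le_add (v := v) (w := w) (ε := dist v w)
    (fun i => by linarith [le_abs_self (v i - w i), hd i]) k
  have h2 := orderStat_le_add (v := w) (w := v) (ε := dist v w)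
    (fun i => by linarith [neg_abs_le (v i - w i), hd i]) k
  rw [Real.dist_eq, NNReal.coe_one, one_mul, abs_le]
  constructor <;> linarith

theorem sampleMedian_eq (hr : 0 < r) (v : Fin r → ℝ) :
    sampleMedian v =
      (orderStat v ⟨(r - 1) / 2, by omega⟩ + orderStat v ⟨r / 2, by omega⟩) / 2 := by
  simp [sampleMedian, hr, orderStat]

theorem continuous_sampleMedian : Continuous fun v : Fin r → ℝ => sampleMedian v := by
  rcases Nat.eq_zero_or_pos r with rfl | hr
  · simp only [sampleMedian, lt_irrefl, dite_false]; exact continuous_const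
  · simp_rw [sampleMedian_eq hr]
    exact ((continuous_orderStat _).add (continuous_orderStat _)).div_const _

theorem sampleMedian_affine (hr : 0 < r) (v : Fin r → ℝ) {c : ℝ} (hc : 0 ≤ c) (d : ℝ) :
    sampleMedian (fun j => c * v j + d) = c * sampleMedian v + d := by
  rw [sampleMedian_eq hr, sampleMedian_eq hr, orderStat_affine v hc, orderStat_affine v hc]
  ring

theorem orderStat_le_sampleMedian (hr : 0 < r) (v : Fin r → ℝ) :
    orderStat v ⟨(r - 1) / 2, by omega⟩ ≤ sampleMedian v := by
  have : orderStat v ⟨(r - 1) / 2, by omega⟩ ≤ orderStat v ⟨r / 2, by omega⟩ :=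
    orderStat_mono v (by simp only [Fin.mk_le_mk]; omega)
  rw [sampleMedian_eq hr]; linarith

theorem sampleMedian_le_orderStat (hr : 0 < r) (v : Fin r → ℝ) :
    sampleMedian v ≤ orderStat v ⟨r / 2, by omega⟩ := by
  have : orderStat v ⟨(r - 1) / 2, by omega⟩ ≤ orderStat v ⟨r / 2, by omega⟩ :=
    orderStat_mono v (by simp only [Fin.mk_le_mk]; omega)
  rw [sampleMedian_eq hr]; linarith

end OrderStatistics

/-! ### A central limit theorem for bounded triangular arrays -/

section CentralLimit

/-- Telescoping: replacing one factor at a time costs `‖a i - b i‖`, since all other factors have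
norm at most `1`. -/
theorem norm_prod_sub_prod_le {ι : Type*} (s : Finset ι) {a b : ι → ℂ}
    (ha : ∀ i, ‖a i‖ ≤ 1) (hb : ∀ i, ‖b i‖ ≤ 1) :
    ‖∏ i ∈ s, a i - ∏ i ∈ s, b i‖ ≤ ∑ i ∈ s, ‖a i - b i‖ := by
  classical
  induction s using Finset.induction_on with
  | empty => simp
  | insert i s hi ih =>
    rw [Finset.prod_insert hi, Finset.prod_insert hi, Finset.sum_insert hi]
    have hp : ‖∏ i ∈ s, a i‖ ≤ 1 := by
      rw [norm_prod]
      exact Finset.prod_le_one (fun _ _ => norm_nonneg _) fun j _ => ha j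
    calc ‖a i * ∏ i ∈ s, a i - b i * ∏ i ∈ s, b i‖
        = ‖(a i - b i) * ∏ i ∈ s, a i + b i * (∏ i ∈ s, a i - ∏ i ∈ s, b i)‖ := by
          congr 1; ring
      _ ≤ ‖a i - b i‖ * ‖∏ i ∈ s, a i‖ + ‖b i‖ * ‖∏ i ∈ s, a i - ∏ i ∈ s, b i‖ := by
          refine (norm_add_le _ _).trans ?_
          rw [norm_mul, norm_mul]
      _ ≤ ‖a i - b i‖ * 1 + 1 * ∑ i ∈ s, ‖a i - b i‖ := by
          gcongr
          exact hb i
      _ = _ := by ring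

theorem norm_exp_mul_I_sub_le {x : ℝ} (hx : |x| ≤ 1) :
    ‖Complex.exp (x * Complex.I) - (1 + x * Complex.I - (x : ℂ) ^ 2 / 2)‖ ≤ 3 * |x| ^ 3 := by
  have h := Complex.norm_exp_sub_sum_le_norm_mul_exp (x * Complex.I) 3
  have hn : ‖(x : ℂ) * Complex.I‖ = |x| := by simp
  rw [hn] at h
  have he : Real.exp |x| ≤ 3 :=
    (Real.exp_le_exp.2 hx).trans (by linarith [Real.exp_one_lt_d9])
  have hs : ∑ m ∈ Finset.range 3, ((x : ℂ) * Complex.I) ^ m / (m.factorial : ℂ) =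
      1 + x * Complex.I - (x : ℂ) ^ 2 / 2 := by
    simp [Finset.sum_range_succ, Nat.factorial, mul_pow]
    ring
  rw [hs] at h
  refine h.trans ?_
  rw [mul_comm]
  gcongr

/-- Second order expansion of the characteristic function of a bounded centred variable. -/
theorem norm_integral_exp_sub_le {Ω : Type*} [MeasurableSpace Ω] {μ : Measure Ω}
    [IsProbabilityMeasure μ] {Z : Ω → ℝ} (hZm : AEStronglyMeasurable Z μ) {L : ℝ}
    (hZ : ∀ᵐ x ∂μ, |Z x| ≤ L) (h0 : ∫ x, Z x ∂μ = 0) {s : ℝ} (hs : |s| * L ≤ 1) :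
    ‖∫ x, Complex.exp ((s * Z x : ℝ) * Complex.I) ∂μ -
      (1 - (s ^ 2 * (∫ x, Z x ^ 2 ∂μ) / 2 : ℝ))‖ ≤ 3 * (|s| * L) ^ 3 := by
  have hi1 : Integrable Z μ := Integrable.of_bound hZm L (by simpa using hZ)
  have hi2 : Integrable (fun x => Z x ^ 2) μ := by
    refine Integrable.of_bound (hZm.pow 2) (L ^ 2) ?_
    filter_upwards [hZ] with x hx
    rw [Real.norm_eq_abs, abs_pow]
    gcongr
  have hie : Integrable (fun x => Complex.exp ((s * Z x : ℝ) * Complex.I)) μ := by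
    refine Integrable.of_bound ?_ 1 (ae_of_all _ fun x => ?_)
    · exact (by fun_prop : Continuous fun z : ℝ =>
        Complex.exp ((s * z : ℝ) * Complex.I)).comp_aestronglyMeasurable hZm
    · rw [Complex.norm_exp_ofReal_mul_I]
  have hiq : Integrable (fun x => (1 : ℂ) + ((s * Z x : ℝ) : ℂ) * Complex.I -
      ((s * Z x : ℝ) : ℂ) ^ 2 / 2) μ := by
    refine ((integrable_const _).add ((hi1.const_mul s).ofReal.mul_const _)).sub ?_
    have := ((hi2.const_mul (s ^ 2 / 2)).ofReal (𝕜 := ℂ))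
    refine this.congr (ae_of_all _ fun x => ?_)
    simp; ring
  have hq : ∫ x, ((1 : ℂ) + ((s * Z x : ℝ) : ℂ) * Complex.I - ((s * Z x : ℝ) : ℂ) ^ 2 / 2) ∂μ =
      1 - ((s ^ 2 * (∫ x, Z x ^ 2 ∂μ) / 2 : ℝ) : ℂ) := by
    have e : ∀ x, ((1 : ℂ) + ((s * Z x : ℝ) : ℂ) * Complex.I - ((s * Z x : ℝ) : ℂ) ^ 2 / 2) =
        1 + ((s * Z x : ℝ) : ℂ) * Complex.I - ((s ^ 2 / 2 * Z x ^ 2 : ℝ) : ℂ) := fun x => by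
      push_cast; ring
    simp_rw [e]
    have i1 : Integrable (fun x => ((s * Z x : ℝ) : ℂ) * Complex.I) μ :=
      (hi1.const_mul s).ofReal.mul_const _
    have i2 : Integrable (fun x => ((s ^ 2 / 2 * Z x ^ 2 : ℝ) : ℂ)) μ :=
      (hi2.const_mul (s ^ 2 / 2)).ofReal
    have i0 : Integrable (fun x => (1 : ℂ) + ((s * Z x : ℝ) : ℂ) * Complex.I) μ :=
      (integrable_const _).add i1
    rw [integral_sub i0 i2, integral_add (integrable_const _) i1,
      integral_mul_const, integral_complex_ofReal, integral_complex_ofReal, integral_const_mul, integral_const_mul,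
      h0]
    simp
    ring
  rw [← hq, ← integral_sub hie hiq]
  refine (norm_integral_le_of_norm_le_const (C := 3 * (|s| * L) ^ 3) ?_).trans (by simp)
  filter_upwards [hZ] with x hx
  have h1 : |s * Z x| ≤ |s| * L := by rw [abs_mul]; gcongr
  refine (norm_exp_mul_I_sub_le (h1.trans hs)).trans ?_
  gcongr

/-- A central limit theorem, on the level of characteristic functions, for triangular arrays of
uniformly bounded centred variables. -/
theorem tendsto_prod_integral_exp {Ω : Type*} [MeasurableSpace Ω] {K : ℕ → ℕ}
    (hK : Tendsto K atTop atTop) (μ : ∀ n, Fin (K n) → Measure Ω)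
    [∀ n j, IsProbabilityMeasure (μ n j)] (Z : ∀ n, Fin (K n) → Ω → ℝ)
    (hZm : ∀ n j, AEStronglyMeasurable (Z n j) (μ n j)) {L : ℝ} (hL : 0 ≤ L)
    (hZ : ∀ n j, ∀ᵐ x ∂μ n j, |Z n j x| ≤ L) (h0 : ∀ n j, ∫ x, Z n j x ∂μ n j = 0) {v : ℝ}
    (hv : Tendsto (fun n => (1 / (K n : ℝ)) * ∑ j, ∫ x, Z n j x ^ 2 ∂μ n j) atTop (𝓝 v)) (t : ℝ) :
    Tendsto (fun n => ∏ j, ∫ x, Complex.exp ((t / √(K n) * Z n j x : ℝ) * Complex.I) ∂μ n j) atTop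
      (𝓝 (Complex.exp ((-(t ^ 2 * v / 2) : ℝ) : ℂ))) := by
  have hK' : Tendsto (fun n => (K n : ℝ)) atTop atTop := tendsto_natCast_atTop_atTop.comp hK
  have hsq : Tendsto (fun n => √(K n : ℝ)) atTop atTop := Real.tendsto_sqrt_atTop.comp hK'
  set w : ∀ n, Fin (K n) → ℝ := fun n j => ∫ x, Z n j x ^ 2 ∂μ n j with hw
  have hw0 : ∀ n j, 0 ≤ w n j := fun n j => integral_nonneg fun x => sq_nonneg _
  have hwL : ∀ n j, w n j ≤ L ^ 2 := fun n j => by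
    have := norm_integral_le_of_norm_le_const (μ := μ n j) (f := fun x => Z n j x ^ 2)
      (C := L ^ 2) (by
        filter_upwards [hZ n j] with x hx
        rw [Real.norm_eq_abs, abs_pow]
        gcongr)
    simpa using (le_abs_self _).trans this
  -- Gaussian factors with the same variances. Their product depends only on the average variance,
  -- so its limit is read off from `hv`.
  set b : ∀ n, Fin (K n) → ℂ := fun n j =>
    Complex.exp ((-((t / √(K n)) ^ 2 * w n j / 2) : ℝ) : ℂ) with hb
  have hlim : Tendsto (fun n => ∏ j, b n j) atTop
      (𝓝 (Complex.exp ((-(t ^ 2 * v / 2) : ℝ) : ℂ))) := by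
    have h1 : ∀ n, ∏ j, b n j =
        Complex.exp ((-(t ^ 2 * ((1 / (K n : ℝ)) * ∑ j, w n j) / 2) : ℝ) : ℂ) := fun n => by
      rw [hb, ← Complex.exp_sum, ← Complex.ofReal_sum]
      congr 2
      rw [div_pow, Real.sq_sqrt (Nat.cast_nonneg _), Finset.sum_neg_distrib, ← Finset.sum_div,
        ← Finset.mul_sum]
      ring
    simp_rw [h1]
    refine (Complex.continuous_exp.tendsto _).comp ((Complex.continuous_ofReal.tendsto _).comp ?_)
    exact ((hv.const_mul (t ^ 2)).div_const 2).neg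
  have hdiff : Tendsto (fun n =>
      (∏ j, ∫ x, Complex.exp ((t / √(K n) * Z n j x : ℝ) * Complex.I) ∂μ n j) - ∏ j, b n j)
      atTop (𝓝 0) := by
    -- Each of the `K n` factors errs by at most `4 (|t| L / √K)^3`: `3` from the expansion of the
    -- characteristic function and `1` from that of the Gaussian factor. The sum is `4 (|t| L)^3 /
    -- √K`.
    have hz : Tendsto (fun n => 4 * (|t| * L) ^ 3 * (√(K n : ℝ))⁻¹) atTop (𝓝 0) := by
      simpa using hsq.inv_tendsto_atTop.const_mul (4 * (|t| * L) ^ 3)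
    refine squeeze_zero_norm' ?_ hz
    filter_upwards [hsq.eventually_ge_atTop (|t| * L), hsq.eventually_gt_atTop 0] with n hn hpos
    have hsn : |t / √(K n : ℝ)| * L = |t| * L / √(K n : ℝ) := by
      rw [abs_div, abs_of_pos hpos]; ring
    have hs1 : |t / √(K n : ℝ)| * L ≤ 1 := by
      rw [hsn]; exact (div_le_one hpos).2 hn
    have hsnn : 0 ≤ |t / √(K n : ℝ)| * L := by positivity
    refine (norm_prod_sub_prod_le _ (fun j => ?_) (fun j => ?_)).trans ?_
    · refine (norm_integral_le_of_norm_le_const (C := 1) (ae_of_all _ fun x => ?_)).trans (by simp)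
      rw [Complex.norm_exp_ofReal_mul_I]
    · rw [hb, Complex.norm_exp, Complex.ofReal_re, Real.exp_le_one_iff]
      have := hw0 n j
      have : 0 ≤ (t / √(K n : ℝ)) ^ 2 * w n j / 2 := by positivity
      linarith
    · have hterm : ∀ j, ‖∫ x, Complex.exp ((t / √(K n) * Z n j x : ℝ) * Complex.I) ∂μ n j - b n j‖
          ≤ 4 * (|t / √(K n : ℝ)| * L) ^ 3 := fun j => by
        set u : ℝ := (t / √(K n)) ^ 2 * w n j / 2 with hu
        have hu0 : 0 ≤ u := by have := hw0 n j; positivity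
        have hsq1 : (|t / √(K n : ℝ)| * L) ^ 2 ≤ 1 := pow_le_one₀ hsnn hs1
        have huL : u ≤ (|t / √(K n : ℝ)| * L) ^ 2 := by
          rw [mul_pow, sq_abs, hu]
          have := mul_le_mul_of_nonneg_left (hwL n j) (sq_nonneg (t / √(K n : ℝ)))
          have h3 : 0 ≤ (t / √(K n : ℝ)) ^ 2 * w n j := mul_nonneg (sq_nonneg _) (hw0 n j)
          linarith
        have h1 := norm_integral_exp_sub_le (hZm n j) (hZ n j) (h0 n j) hs1
        have h2 : ‖(1 - (u : ℂ)) - b n j‖ ≤ (|t / √(K n : ℝ)| * L) ^ 3 := by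
          have h4 : ‖((-u : ℝ) : ℂ)‖ ≤ 1 := by
            rw [Complex.norm_real, norm_neg, Real.norm_of_nonneg hu0]; linarith
          have h3 := Complex.norm_exp_sub_one_sub_id_le h4
          rw [Complex.norm_real, norm_neg, Real.norm_of_nonneg hu0] at h3
          have e : (1 - (u : ℂ)) - b n j =
              -(Complex.exp ((-u : ℝ) : ℂ) - 1 - ((-u : ℝ) : ℂ)) := by
            rw [show b n j = Complex.exp ((-u : ℝ) : ℂ) from rfl]; push_cast; ring
          rw [e, norm_neg]
          refine h3.trans ((pow_le_pow_left₀ hu0 huL 2).trans ?_)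
          rw [← pow_mul]
          exact pow_le_pow_of_le_one hsnn hs1 (by norm_num)
        calc _ = ‖(∫ x, Complex.exp ((t / √(K n) * Z n j x : ℝ) * Complex.I) ∂μ n j
              - (1 - (u : ℂ))) + ((1 - (u : ℂ)) - b n j)‖ := by congr 1; ring
          _ ≤ 3 * (|t / √(K n : ℝ)| * L) ^ 3 + (|t / √(K n : ℝ)| * L) ^ 3 :=
              (norm_add_le _ _).trans (add_le_add h1 h2)
          _ = _ := by ring
      refine (Finset.sum_le_sum fun j _ => hterm j).trans (le_of_eq ?_)
      rw [Finset.sum_const, Finset.card_univ, Fintype.card_fin, nsmul_eq_mul, hsn]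
      have h5 : (K n : ℝ) = √(K n : ℝ) ^ 2 := (Real.sq_sqrt (Nat.cast_nonneg _)).symm
      rw [div_pow]
      nth_rewrite 1 [h5]
      field_simp
  simpa using hdiff.add hlim

end CentralLimit

/-! ### Asymptotics of the median of a Gaussian sample -/

section GaussianMedian

/-- Pointwise convergence of the distribution functions implies weak convergence. -/
theorem tendsto_probabilityMeasure_of_tendsto_Iic {μ : ℕ → ProbabilityMeasure ℝ}
    {ν : ProbabilityMeasure ℝ}
    (h : ∀ x, Tendsto (fun n => (μ n : Measure ℝ).real (Set.Iic x)) atTop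
      (𝓝 ((ν : Measure ℝ).real (Set.Iic x)))) :
    Tendsto μ atTop (𝓝 ν) := by
  -- Half-open intervals form a π-system containing small neighbourhoods of every point, and their
  -- masses are differences of distribution function values.
  refine (isPiSystem_Ioc (id : ℝ → ℝ) id).tendsto_probabilityMeasure_of_tendsto_of_mem ?_ ?_ ?_
  · rintro _ ⟨a, b, -, rfl⟩
    exact measurableSet_Ioc
  · intro u hu x hx
    obtain ⟨ε, hε, hb⟩ := Metric.isOpen_iff.1 hu x hx
    refine ⟨Set.Ioc (x - ε / 2) (x + ε / 2), ⟨x - ε / 2, x + ε / 2, by simp; linarith, rfl⟩,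
      Ioc_mem_nhds (by linarith) (by linarith), fun y hy => hb ?_⟩
    rw [Metric.mem_ball, Real.dist_eq, abs_lt]
    constructor <;> linarith [hy.1, hy.2]
  · rintro _ ⟨a, b, hab, rfl⟩
    have key : ∀ ρ : ProbabilityMeasure ℝ, (ρ : Measure ℝ).real (Set.Ioc a b) =
        (ρ : Measure ℝ).real (Set.Iic b) - (ρ : Measure ℝ).real (Set.Iic a) := fun ρ => by
      have hab' : a ≤ b := le_of_lt hab
      rw [← measureReal_sdiff (Set.Iic_subset_Iic.2 hab') measurableSet_Iic]
      congr 1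
      ext y
      simp [and_comm]
    have h2 := (h b).sub (h a)
    simp_rw [← key] at h2
    have h3 : Tendsto (fun n => ((μ n (Set.Ioc a b) : ℝ≥0) : ℝ)) atTop
      (𝓝 ((ν (Set.Ioc a b) : ℝ≥0) : ℝ)) := h2
    exact NNReal.tendsto_coe.1 h3

theorem gaussianReal_real_Iic_zero : (gaussianReal 0 1).real (Set.Iic 0) = 1 / 2 := by
  have := nullSingletonClass_gaussianReal (μ := 0) (v := 1) one_ne_zero
  have h1 : (gaussianReal 0 1).real (Set.Ici 0) = (gaussianReal 0 1).real (Set.Iic 0) := by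
    have h := gaussianReal_map_neg (μ := 0) (v := 1)
    rw [neg_zero] at h
    nth_rewrite 1 [← h]
    rw [map_measureReal_apply measurable_neg measurableSet_Ici]
    congr 1
    ext x
    simp
  have h2 : (gaussianReal 0 1).real (Set.Iic 0) + (gaussianReal 0 1).real (Set.Ioi 0) = 1 := by
    rw [← measureReal_union (by rw [Set.disjoint_left]; intro x; simp) measurableSet_Ioi,
      Set.Iic_union_Ioi, probReal_univ]
  have h3 : (gaussianReal 0 1).real (Set.Ioi 0) = (gaussianReal 0 1).real (Set.Ici 0) := by
    rw [measureReal_def, measureReal_def, measure_congr Ioi_ae_eq_Ici]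
  linarith

/-- The Gaussian density at the median is the origin of the factor `π/2` in the limit variance. -/
theorem hasDerivAt_gaussianReal_real_Iic_zero :
    HasDerivAt (fun y => (gaussianReal 0 1).real (Set.Iic y)) (√(2 * Real.pi))⁻¹ 0 := by
  have hc : Continuous (gaussianPDFReal 0 1) := by
    unfold gaussianPDFReal; fun_prop
  have hi := integrable_gaussianPDFReal 0 1
  have hF : ∀ y, (gaussianReal 0 1).real (Set.Iic y) = ∫ x in Set.Iic y, gaussianPDFReal 0 1 x :=
    fun y => by
      rw [measureReal_def, gaussianReal_apply_eq_integral 0 one_ne_zero, ENNReal.toReal_ofReal]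
      exact setIntegral_nonneg measurableSet_Iic fun x _ => gaussianPDFReal_nonneg 0 1 x
  have hF2 : ∀ y, (gaussianReal 0 1).real (Set.Iic y) =
      (∫ x in (0 : ℝ)..y, gaussianPDFReal 0 1 x) + (gaussianReal 0 1).real (Set.Iic 0) :=
    fun y => by
      rw [hF, hF, ← intervalIntegral.integral_Iic_sub_Iic hi.integrableOn hi.integrableOn]
      ring
  have hd := (intervalIntegral.integral_hasDerivAt_right (hc.intervalIntegrable 0 0)
    (hc.stronglyMeasurableAtFilter _ _) hc.continuousAt).add_const
      ((gaussianReal 0 1).real (Set.Iic 0))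
  refine (hd.congr_of_eventuallyEq (Eventually.of_forall hF2)).congr_deriv ?_
  simp [gaussianPDFReal]

/-- The expression is the slope at `0` of `s ↦ Φ(s x)`, with `Φ` the standard normal distribution
function, taken along `s = 1/√r`. -/
theorem tendsto_sqrt_mul_gaussianReal_Iic_sub (x : ℝ) :
    Tendsto (fun r : ℕ => √(r : ℝ) * ((gaussianReal 0 1).real (Set.Iic (x / √(r : ℝ))) - 1 / 2))
      atTop (𝓝 (x * (√(2 * Real.pi))⁻¹)) := by
  have h1 : HasDerivAt (fun s : ℝ => (gaussianReal 0 1).real (Set.Iic (s * x)))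
      ((√(2 * Real.pi))⁻¹ * x) 0 := by
    have h0 : HasDerivAt (fun s : ℝ => s * x) x 0 := by
      simpa using (hasDerivAt_id (0 : ℝ)).mul_const x
    have h2 : HasDerivAt (fun y => (gaussianReal 0 1).real (Set.Iic y)) (√(2 * Real.pi))⁻¹
        ((fun s : ℝ => s * x) 0) := by
      simpa using hasDerivAt_gaussianReal_real_Iic_zero
    exact h2.comp (0 : ℝ) h0
  have h3 : Tendsto (fun r : ℕ => (√(r : ℝ))⁻¹) atTop (𝓝[≠] 0) := by
    have hs : Tendsto (fun r : ℕ => √(r : ℝ)) atTop atTop :=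
      Real.tendsto_sqrt_atTop.comp tendsto_natCast_atTop_atTop
    refine tendsto_nhdsWithin_iff.2 ⟨hs.inv_tendsto_atTop, ?_⟩
    filter_upwards [hs.eventually_gt_atTop 0] with r hr
    exact inv_ne_zero hr.ne'
  have h4 := h1.tendsto_slope.comp h3
  rw [mul_comm] at h4
  refine h4.congr fun r => ?_
  simp only [Function.comp_apply, slope_def_field, zero_mul, gaussianReal_real_Iic_zero, sub_zero,
    div_inv_eq_mul]
  rw [mul_comm, inv_mul_eq_div]

/-- The centred indicator function of `(-∞, y]`. -/
noncomputable def centredIndicator (y : ℝ) : ℝ → ℝ := fun x =>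
  (Set.Iic y).indicator 1 x - (gaussianReal 0 1).real (Set.Iic y)

theorem measurable_centredIndicator (y : ℝ) : Measurable (centredIndicator y) :=
  (measurable_one.indicator measurableSet_Iic).sub_const _

theorem abs_centredIndicator_le (y x : ℝ) : |centredIndicator y x| ≤ 1 := by
  have h0 : 0 ≤ (gaussianReal 0 1).real (Set.Iic y) := measureReal_nonneg
  have h1 : (gaussianReal 0 1).real (Set.Iic y) ≤ 1 := measureReal_le_one
  unfold centredIndicator
  by_cases h : x ∈ Set.Iic y
  · rw [Set.indicator_of_mem h, Pi.one_apply, abs_le]; constructor <;> linarith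
  · rw [Set.indicator_of_notMem h, abs_le]; constructor <;> linarith

theorem integral_centredIndicator (y : ℝ) : ∫ x, centredIndicator y x ∂gaussianReal 0 1 = 0 := by
  have hi : Integrable ((Set.Iic y).indicator (1 : ℝ → ℝ)) (gaussianReal 0 1) :=
    (integrable_const (1 : ℝ)).indicator measurableSet_Iic
  unfold centredIndicator
  rw [integral_sub hi (integrable_const _), integral_indicator_one measurableSet_Iic]
  simp

theorem integral_centredIndicator_sq (y : ℝ) : ∫ x, centredIndicator y x ^ 2 ∂gaussianReal 0 1 =
    (gaussianReal 0 1).real (Set.Iic y) * (1 - (gaussianReal 0 1).real (Set.Iic y)) := by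
  set p := (gaussianReal 0 1).real (Set.Iic y) with hp
  have hi : Integrable ((Set.Iic y).indicator (1 : ℝ → ℝ)) (gaussianReal 0 1) :=
    (integrable_const (1 : ℝ)).indicator measurableSet_Iic
  have e : ∀ x, centredIndicator y x ^ 2 =
      (1 - 2 * p) * (Set.Iic y).indicator (1 : ℝ → ℝ) x + p ^ 2 := fun x => by
    unfold centredIndicator
    rw [← hp]
    by_cases h : x ∈ Set.Iic y
    · rw [Set.indicator_of_mem h, Pi.one_apply]; ring
    · rw [Set.indicator_of_notMem h]; ring
  simp_rw [e]
  rw [integral_add (hi.const_mul _) (integrable_const _), integral_const_mul,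
    integral_indicator_one measurableSet_Iic, ← hp]
  simp
  ring

/-- The joint law of `r` independent `N(0,1)` variables. -/
noncomputable abbrev stdGaussianPi (r : ℕ) : Measure (Fin r → ℝ) :=
  Measure.pi fun _ : Fin r => gaussianReal 0 1

/-- The normalised number of coordinates in `(-∞, y]`. -/
noncomputable def normalisedCount (r : ℕ) (y a : ℝ) (v : Fin r → ℝ) : ℝ :=
  (√(r : ℝ))⁻¹ * ((∑ j, (Set.Iic y).indicator (1 : ℝ → ℝ) (v j)) - a)

theorem measurable_normalisedCount (r : ℕ) (y a : ℝ) : Measurable (normalisedCount r y a) := by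
  refine Measurable.const_mul (Measurable.sub_const ?_ _) _
  exact Finset.measurable_sum _ fun j _ =>
    (measurable_one.indicator measurableSet_Iic).comp (measurable_pi_apply j)

/-- The count is a sum of centred indicators plus a deterministic drift; the drift gives the
exponential and independence gives the product. -/
theorem charFun_normalisedCount (r : ℕ) (y a t : ℝ) :
    charFun ((stdGaussianPi r).map (normalisedCount r y a)) t =
      Complex.exp ((t * ((√(r : ℝ))⁻¹ * (r * (gaussianReal 0 1).real (Set.Iic y) - a)) : ℝ) *
        Complex.I) * ∏ _j : Fin r, ∫ x, Complex.exp ((t / √(r : ℝ) * centredIndicator y x : ℝ) *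
          Complex.I) ∂gaussianReal 0 1 := by
  rw [charFun_apply_real, integral_map (measurable_normalisedCount r y a).aemeasurable
    (by fun_prop), ← integral_fintype_prod_eq_prod, ← integral_const_mul]
  congr 1
  ext v
  rw [← Complex.exp_sum, ← Complex.exp_add]
  congr 1
  rw [← Finset.sum_mul, ← add_mul, ← Complex.ofReal_sum, ← Complex.ofReal_add,
    ← Complex.ofReal_mul]
  congr 2
  rw [← Finset.mul_sum]
  simp only [normalisedCount, centredIndicator, Finset.sum_sub_distrib, Finset.sum_const,
    Finset.card_univ, Fintype.card_fin, nsmul_eq_mul]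
  ring

/-- With `p` the mass of `(-∞, x/√r]`, the drift `(r p - a)/√r` tends to `x/√(2π)` and the variance
`p (1 - p)` to `1/4`. A bounded deviation of `a` from `r/2` disappears after division by `√r`. -/
theorem tendsto_normalisedCount (x : ℝ) {a : ℕ → ℝ} (ha : ∀ r, |a r - r / 2| ≤ 1) :
    Tendsto (β := ProbabilityMeasure ℝ) (fun r : ℕ => ⟨(stdGaussianPi r).map (normalisedCount r (x / √(r : ℝ)) (a r)),
        Measure.isProbabilityMeasure_map (measurable_normalisedCount _ _ _).aemeasurable⟩) atTop
      (𝓝 ⟨gaussianReal (x * (√(2 * Real.pi))⁻¹) (1 / 4), inferInstance⟩) := by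
  refine ProbabilityMeasure.tendsto_iff_tendsto_charFun.2 fun t => ?_
  simp only [ProbabilityMeasure.coe_mk]
  simp_rw [charFun_normalisedCount, charFun_gaussianReal]
  have hs : Tendsto (fun r : ℕ => √(r : ℝ)) atTop atTop :=
    Real.tendsto_sqrt_atTop.comp tendsto_natCast_atTop_atTop
  have hp := tendsto_sqrt_mul_gaussianReal_Iic_sub x
  set p : ℕ → ℝ := fun r => (gaussianReal 0 1).real (Set.Iic (x / √(r : ℝ))) with hpdef
  have hp2 : Tendsto p atTop (𝓝 (1 / 2)) := by
    have h := (hs.inv_tendsto_atTop.mul hp).add_const (1 / 2)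
    rw [zero_mul, zero_add] at h
    refine h.congr' ?_
    filter_upwards [hs.eventually_gt_atTop 0] with r hr
    simp only [Pi.inv_apply]
    field_simp
    ring
  have hshift : Tendsto (fun r : ℕ => (√(r : ℝ))⁻¹ * (r * p r - a r)) atTop
      (𝓝 (x * (√(2 * Real.pi))⁻¹)) := by
    have hz : Tendsto (fun r : ℕ => (√(r : ℝ))⁻¹ * (a r - r / 2)) atTop (𝓝 0) := by
      refine squeeze_zero_norm (fun r => ?_) hs.inv_tendsto_atTop
      rw [norm_mul, Real.norm_eq_abs, Real.norm_eq_abs, abs_of_nonneg (by positivity)]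
      exact mul_le_of_le_one_right (by positivity) (ha r)
    have h := hp.sub hz
    rw [sub_zero] at h
    refine h.congr fun r => ?_
    have hr : (r : ℝ) = √(r : ℝ) * √(r : ℝ) := (Real.mul_self_sqrt (Nat.cast_nonneg _)).symm
    rcases eq_or_ne (√(r : ℝ)) 0 with h0 | h0
    · simp [h0]
    · have : (√(r : ℝ))⁻¹ * (r * p r) = √(r : ℝ) * p r := by
        nth_rewrite 2 [hr]; field_simp
      have h6 : (√(r : ℝ))⁻¹ * (r / 2) = √(r : ℝ) * (1 / 2) := by
        nth_rewrite 2 [hr]; field_simp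
      rw [mul_sub, mul_sub, mul_sub, this, h6]
      ring
  have hprod := tendsto_prod_integral_exp (K := fun n => n) tendsto_id
    (fun _ _ => gaussianReal 0 1) (fun n _ => centredIndicator (x / √(n : ℝ)))
    (fun n _ => (measurable_centredIndicator _).aestronglyMeasurable) zero_le_one
    (fun n _ => ae_of_all _ (abs_centredIndicator_le _)) (fun n _ => integral_centredIndicator _)
    (v := 1 / 4) (by
      simp_rw [integral_centredIndicator_sq]
      have h := hp2.mul (hp2.const_sub 1)
      norm_num at h
      norm_num
      refine h.congr' ?_
      filter_upwards [eventually_gt_atTop 0] with n hn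
      have : (n : ℝ) ≠ 0 := by positivity
      rw [inv_mul_cancel_left₀ this]) t
  have hexp : Tendsto (fun r : ℕ => Complex.exp ((t * ((√(r : ℝ))⁻¹ * (r * p r - a r)) : ℝ) *
      Complex.I)) atTop (𝓝 (Complex.exp ((t * (x * (√(2 * Real.pi))⁻¹) : ℝ) * Complex.I))) :=
    ((by fun_prop : Continuous fun z : ℝ => Complex.exp ((t * z : ℝ) * Complex.I)).tendsto _).comp
      hshift
  convert! hexp.mul hprod using 2
  rw [← Complex.exp_add]
  congr 1
  push_cast
  ring

/-- If `Y` has law `N(0, π/2)`, then `(x - Y)/√(2π)` has mean `x/√(2π)` and variance `(π/2)/(2π) =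
1/4`, and it is nonnegative exactly when `Y ≤ x`. -/
theorem gaussianReal_Ici_zero_eq (x : ℝ) :
    gaussianReal (x * (√(2 * Real.pi))⁻¹) (1 / 4) (Set.Ici 0) =
      gaussianReal 0 (Real.toNNReal (Real.pi / 2)) (Set.Iic x) := by
  have hpos : 0 < (√(2 * Real.pi))⁻¹ := by positivity
  have h1 : gaussianReal (x * (√(2 * Real.pi))⁻¹) (1 / 4) =
      (gaussianReal 0 (Real.toNNReal (Real.pi / 2))).map
        (fun y => (-(√(2 * Real.pi))⁻¹) * y + x * (√(2 * Real.pi))⁻¹) := by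
    have hcomp : (fun y => (-(√(2 * Real.pi))⁻¹) * y + x * (√(2 * Real.pi))⁻¹) =
        (fun y => y + x * (√(2 * Real.pi))⁻¹) ∘ (fun y => (-(√(2 * Real.pi))⁻¹) * y) := rfl
    rw [hcomp, ← Measure.map_map (by fun_prop) (by fun_prop), gaussianReal_map_const_mul,
      gaussianReal_map_add_const]
    congr 1
    · ring
    · ext
      simp only [NNReal.coe_mul, NNReal.coe_mk]
      rw [Real.coe_toNNReal _ (by positivity), neg_sq, inv_pow, Real.sq_sqrt (by positivity)]
      field_simp
      norm_num
  rw [h1, Measure.map_apply (by fun_prop) measurableSet_Ici]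
  congr 1
  ext y
  simp only [Set.mem_preimage, Set.mem_Ici, Set.mem_Iic]
  rw [show -(√(2 * Real.pi))⁻¹ * y + x * (√(2 * Real.pi))⁻¹ = (√(2 * Real.pi))⁻¹ * (x - y) by ring,
    mul_nonneg_iff_of_pos_left hpos, sub_nonneg]

/-- The order statistic of index `k r` is at most `x/√r` exactly when at least `k r + 1` coordinates
are, that is, when the count normalised with `a = k r + 1` lies in `[0, ∞)`, a set whose frontier is
null for the Gaussian limit. -/
theorem tendsto_real_orderStat_le (x : ℝ) (k : ℕ → ℕ) (hk : ∀ r, 0 < r → k r < r)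
    (hk2 : ∀ r, |((k r : ℝ) + 1) - r / 2| ≤ 1) :
    Tendsto (fun r : ℕ => (stdGaussianPi r).real
        {v | ∀ h : 0 < r, √(r : ℝ) * orderStat v ⟨k r, hk r h⟩ ≤ x}) atTop
      (𝓝 ((gaussianReal 0 (Real.toNNReal (Real.pi / 2))).real (Set.Iic x))) := by
  have hv : (1 / 4 : ℝ≥0) ≠ 0 := by norm_num
  have := nullSingletonClass_gaussianReal (μ := x * (√(2 * Real.pi))⁻¹) hv
  have h := ProbabilityMeasure.tendsto_measure_of_null_frontier_of_tendsto'
    (tendsto_normalisedCount x hk2) (E := Set.Ici 0) (by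
      simp only [ProbabilityMeasure.coe_mk]
      rw [frontier_Ici]
      exact measure_singleton _)
  simp only [ProbabilityMeasure.coe_mk, gaussianReal_Ici_zero_eq] at h
  have h' := (ENNReal.tendsto_toReal (measure_ne_top _ _)).comp h
  refine h'.congr' ?_
  filter_upwards [eventually_gt_atTop 0] with r hr
  simp only [Function.comp_apply]
  rw [measureReal_def, Measure.map_apply (measurable_normalisedCount _ _ _) measurableSet_Ici]
  congr 2
  ext v
  have hs : 0 < √(r : ℝ) := by positivity
  simp only [Set.mem_preimage, Set.mem_Ici, Set.mem_ofPred_eq, hr, forall_true_left,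
    normalisedCount]
  rw [mul_nonneg_iff_of_pos_left (inv_pos.2 hs), ← le_div_iff₀' hs, orderStat_le_iff,
    ← Nat.succ_le_iff, ← Nat.cast_le (α := ℝ), sub_nonneg, Finset.card_filter]
  push_cast
  simp [Set.indicator_apply]

theorem continuous_mul_sampleMedian (c : ℝ) (r : ℕ) :
    Continuous fun w : Fin r → ℝ => c * sampleMedian w :=
  continuous_const.mul continuous_sampleMedian

/-- The law of `√r` times the sample median of `r` independent `N(0,v)` variables. -/
noncomputable def gaussianMedianLaw (v : ℝ≥0) (r : ℕ) : ProbabilityMeasure ℝ :=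
  ⟨(Measure.pi fun _ : Fin r => gaussianReal 0 v).map fun w => √(r : ℝ) * sampleMedian w,
    Measure.isProbabilityMeasure_map
      (continuous_mul_sampleMedian _ _).measurable.aemeasurable⟩

theorem tendsto_gaussianMedianLaw_one :
    Tendsto (gaussianMedianLaw 1) atTop
      (𝓝 ⟨gaussianReal 0 (Real.toNNReal (Real.pi / 2)), inferInstance⟩) := by
  refine tendsto_probabilityMeasure_of_tendsto_Iic fun x => ?_
  -- Both middle order statistics have rank within `1` of `r/2`, so they share one limit law; the
  -- median lies between them.
  have hpar : ∀ r : ℕ, ∃ q e : ℕ, r = 2 * q + e ∧ (e = 0 ∨ e = 1) := fun r =>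
    ⟨r / 2, r % 2, by omega, by omega⟩
  have hlo := tendsto_real_orderStat_le x (fun r => (r - 1) / 2) (fun r h => by omega) (fun r => by
    rcases Nat.eq_zero_or_pos r with rfl | h0
    · norm_num
    · obtain ⟨q, e, hqe, he | he⟩ := hpar r
      · have hq : (r - 1) / 2 + 1 = q := by omega
        have hq' : (((r - 1) / 2 : ℕ) : ℝ) + 1 = q := by exact_mod_cast hq
        rw [hq', hqe, he]; push_cast
        rw [abs_le]; constructor <;> linarith
      · have hq : (r - 1) / 2 = q := by omega
        rw [hq, hqe, he]; push_cast
        rw [abs_le]; constructor <;> linarith)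
  have hhi := tendsto_real_orderStat_le x (fun r => r / 2) (fun r h => by omega) (fun r => by
    obtain ⟨q, e, hqe, he | he⟩ := hpar r
    · have hq : r / 2 = q := by omega
      rw [hq, hqe, he]; push_cast
      rw [abs_le]; constructor <;> linarith
    · have hq : r / 2 = q := by omega
      rw [hq, hqe, he]; push_cast
      rw [abs_le]; constructor <;> linarith)
  have hm : ∀ r : ℕ, ((gaussianMedianLaw 1 r : ProbabilityMeasure ℝ) : Measure ℝ).real (Set.Iic x) =
      (stdGaussianPi r).real {v | √(r : ℝ) * sampleMedian v ≤ x} := fun r => by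
    simp only [gaussianMedianLaw, ProbabilityMeasure.coe_mk]
    rw [map_measureReal_apply (continuous_mul_sampleMedian _ _).measurable
      measurableSet_Iic]
    rfl
  simp_rw [hm, ProbabilityMeasure.coe_mk]
  refine tendsto_of_tendsto_of_tendsto_of_le_of_le' hhi hlo ?_ ?_
  · filter_upwards [eventually_gt_atTop 0] with r hr
    refine measureReal_mono fun v hv => ?_
    exact (mul_le_mul_of_nonneg_left (sampleMedian_le_orderStat hr v) (Real.sqrt_nonneg _)).trans
      (hv hr)
  · filter_upwards [eventually_gt_atTop 0] with r hr
    refine measureReal_mono fun v hv _ => ?_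
    exact (mul_le_mul_of_nonneg_left (orderStat_le_sampleMedian hr v) (Real.sqrt_nonneg _)).trans
      hv

/-- `N(0, v)` is the law of `√v` times a standard Gaussian, and the median commutes with this
scaling. The argument covers `v = 0`, where all laws are point masses. -/
theorem tendsto_gaussianMedianLaw (v : ℝ≥0) :
    Tendsto (gaussianMedianLaw v) atTop
      (𝓝 ⟨gaussianReal 0 (Real.toNNReal (Real.pi * v / 2)), inferInstance⟩) := by
  have hcont : Continuous fun y : ℝ => √(v : ℝ) * y := by fun_prop
  have h := ProbabilityMeasure.tendsto_map_of_tendsto_of_continuous _ _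
    tendsto_gaussianMedianLaw_one hcont
  have hgen : ∀ u : ℝ≥0, (gaussianReal 0 u).map (fun y => √(v : ℝ) * y) = gaussianReal 0 (v * u) :=
    fun u => by
      rw [gaussianReal_map_const_mul, mul_zero]
      congr 2
      ext
      simp
  have hlim : ProbabilityMeasure.map
      (⟨gaussianReal 0 (Real.toNNReal (Real.pi / 2)), inferInstance⟩ : ProbabilityMeasure ℝ)
        hcont.aemeasurable = ⟨gaussianReal 0 (Real.toNNReal (Real.pi * v / 2)), inferInstance⟩ := by
    apply Subtype.ext
    change (gaussianReal 0 (Real.toNNReal (Real.pi / 2))).map (fun y => √(v : ℝ) * y) = _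
    rw [hgen]
    congr 1
    ext
    rw [NNReal.coe_mul, Real.coe_toNNReal _ (by positivity), Real.coe_toNNReal _ (by positivity)]
    ring
  rw [hlim] at h
  refine h.congr' ?_
  filter_upwards [eventually_gt_atTop 0] with r hr
  apply Subtype.ext
  change ((Measure.pi fun _ : Fin r => gaussianReal 0 1).map
    fun w => √(r : ℝ) * sampleMedian w).map (fun y => √(v : ℝ) * y) =
    (Measure.pi fun _ : Fin r => gaussianReal 0 v).map fun w => √(r : ℝ) * sampleMedian w
  have hmed : Measurable fun w : Fin r → ℝ => √(r : ℝ) * sampleMedian w :=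
    (continuous_mul_sampleMedian _ _).measurable
  have hpi : (Measure.pi fun _ : Fin r => gaussianReal 0 v) =
      (Measure.pi fun _ : Fin r => gaussianReal 0 1).map fun w j => √(v : ℝ) * w j := by
    have := Measure.pi_map_pi (μ := fun _ : Fin r => gaussianReal 0 1)
      (f := fun _ y => √(v : ℝ) * y) (hμ := fun _ => by rw [hgen]; infer_instance)
      (fun _ => hcont.aemeasurable)
    rw [this, hgen, mul_one]
  rw [hpi, Measure.map_map (by fun_prop) hmed, Measure.map_map hmed (by fun_prop)]
  congr 1
  ext w
  simp only [Function.comp_apply]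
  have := sampleMedian_affine hr w (Real.sqrt_nonneg (v : ℝ)) 0
  simp only [add_zero] at this
  rw [this]
  ring

end GaussianMedian

/-! ### Averages over short intervals -/

section BlockAverage

variable {𝕜 : Type*} [RCLike 𝕜]

/-- The average of `g` over `[x, x + δ]`. -/
noncomputable def blockAverage (g : ℝ → 𝕜) (δ x : ℝ) : 𝕜 := ∫ u in (0 : ℝ)..1, g (x + δ * u)

theorem blockAverage_zero (g : ℝ → 𝕜) (x : ℝ) : blockAverage g 0 x = g x := by
  simp [blockAverage]

/-- Continuity includes `δ = 0`, where the average degenerates to the point value; this is what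
allows the number of scrambled digits to tend to infinity. -/
theorem continuous_blockAverage {g : ℝ → 𝕜} (hg : Continuous g) :
    Continuous fun z : ℝ × ℝ => blockAverage g z.1 z.2 :=
  intervalIntegral.continuous_parametric_intervalIntegral_of_continuous'
    (f := fun (z : ℝ × ℝ) u => g (z.2 + z.1 * u)) (by fun_prop) 0 1

theorem norm_blockAverage_le {g : ℝ → 𝕜} (hg : ∀ x, ‖g x‖ ≤ 1) (δ x : ℝ) :
    ‖blockAverage g δ x‖ ≤ 1 := by
  simpa [blockAverage] using intervalIntegral.norm_integral_le_of_norm_le_const (a := 0) (b := 1) (C := 1)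
    (f := fun u => g (x + δ * u)) fun u _ => hg _

theorem blockAverage_eq {g : ℝ → 𝕜} {δ : ℝ} (hδ : δ ≠ 0) (x : ℝ) :
    blockAverage g δ x = (δ : 𝕜)⁻¹ * ∫ y in x..x + δ, g y := by
  rw [blockAverage, intervalIntegral.integral_comp_add_mul _ hδ]
  simp [RCLike.real_smul_eq_coe_mul]

/-- The `b` adjacent intervals of length `δ` tile `[x, x + bδ]`. This serves both to average over
one uniform digit and to split an integral into strata. -/
theorem inv_mul_sum_blockAverage {g : ℝ → 𝕜} (hg : Continuous g) {b : ℕ} (hb : b ≠ 0) {δ : ℝ}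
    (hδ : δ ≠ 0) (x : ℝ) :
    (b : 𝕜)⁻¹ * ∑ c : Fin b, blockAverage g δ (x + c * δ) = blockAverage g (b * δ) x := by
  have hbR : (b : ℝ) ≠ 0 := by exact_mod_cast hb
  have h := intervalIntegral.sum_integral_adjacent_intervals (f := g) (μ := volume)
    (a := fun k : ℕ => x + k * δ) (n := b) fun k _ => hg.intervalIntegrable _ _
  rw [blockAverage_eq (mul_ne_zero hbR hδ), Fin.sum_univ_eq_sum_range
    (fun c : ℕ => blockAverage g δ (x + c * δ))]
  simp_rw [blockAverage_eq hδ]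
  rw [← Finset.mul_sum]
  have h2 : ∀ c : ℕ, x + (c : ℝ) * δ + δ = x + ((c + 1 : ℕ) : ℝ) * δ := fun c => by
    push_cast; ring
  simp_rw [h2]
  rw [h]
  push_cast
  rw [mul_inv, mul_assoc]
  simp

end BlockAverage

/-! ### The product formula for jittered sampling -/

section Jittered

variable {Ω : Type*} [MeasurableSpace Ω] {P : Measure Ω} {N : ℕ} {X : Fin N → Ω → ℝ}

theorem volume_stratum (i : Fin N) :
    volume (Set.Icc ((i : ℝ) / N) (((i : ℝ) + 1) / N)) = ENNReal.ofReal (1 / N) := by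
  rw [Real.volume_Icc]
  congr 1
  ring

theorem IsJitteredSample.aemeasurable (hX : IsJitteredSample P X) (i : Fin N) :
    AEMeasurable (X i) P := by
  have hN : 0 < N := Fin.pos i
  refine pdf.IsUniform.aemeasurable ?_ ?_ (hX.uniform i)
  · rw [volume_stratum, ne_eq, ENNReal.ofReal_eq_zero, not_le]
    positivity
  · rw [volume_stratum]
    exact ENNReal.ofReal_ne_top

theorem IsJitteredSample.ae_mem (hX : IsJitteredSample P X) (i : Fin N) :
    ∀ᵐ ω ∂P, X i ω ∈ Set.Icc (0 : ℝ) 1 := by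
  have hN : (0 : ℝ) < N := by exact_mod_cast Fin.pos i
  have h1 : ∀ᵐ x ∂(P.map (X i)), x ∈ Set.Icc ((i : ℝ) / N) (((i : ℝ) + 1) / N) := by
    rw [hX.uniform i]
    exact ae_cond_mem measurableSet_Icc
  filter_upwards [ae_of_ae_map (hX.aemeasurable i) h1] with ω hω
  have hi : (i : ℝ) + 1 ≤ N := by exact_mod_cast i.2
  exact ⟨le_trans (by positivity) hω.1, hω.2.trans ((div_le_one hN).2 hi)⟩

theorem IsJitteredSample.integral_prod (hX : IsJitteredSample P X) {g : ℝ → ℂ}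
    (hg : Continuous g) :
    ∫ ω, ∏ i, g (X i ω) ∂P = ∏ j : Fin N, blockAverage g (1 / N) ((j : ℝ) / N) := by
  rw [hX.indep.integral_fun_prod_comp hX.aemeasurable fun _ => hg.aestronglyMeasurable]
  refine Finset.prod_congr rfl fun i _ => ?_
  have hN : (0 : ℝ) < N := by exact_mod_cast Fin.pos i
  rw [← integral_map (hX.aemeasurable i) hg.aestronglyMeasurable, hX.uniform i,
    ProbabilityTheory.cond, integral_smul_measure, volume_stratum,
    blockAverage_eq (one_div_ne_zero hN.ne'), integral_Icc_eq_integral_Ioc,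
    ← intervalIntegral.integral_of_le (by gcongr; linarith)]
  rw [ENNReal.toReal_inv, ENNReal.toReal_ofReal (by positivity), add_div]
  simp

end Jittered

/-! ### Uniform permutations and independent digits -/

section PermTree

/-- The image of a fixed digit under a uniform permutation is uniform: composing with a
transposition shows that the sum does not depend on `c`, so it may be averaged over all digits. -/
theorem sum_perm_apply {b : ℕ} (hb : b ≠ 0) (φ : Fin b → ℂ) (c : Fin b) :
    ((b.factorial : ℂ))⁻¹ * ∑ s : Equiv.Perm (Fin b), φ (s c) = (b : ℂ)⁻¹ * ∑ d, φ d := by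
  have hc : ∀ c', ∑ s : Equiv.Perm (Fin b), φ (s c') = ∑ s : Equiv.Perm (Fin b), φ (s c) :=
    fun c' => by
      refine Fintype.sum_equiv (Equiv.mulRight (Equiv.swap c c')) _ _ fun s => ?_
      simp
  have h1 : (b : ℂ) * ∑ s : Equiv.Perm (Fin b), φ (s c) = (b.factorial : ℂ) * ∑ d, φ d := by
    calc (b : ℂ) * ∑ s : Equiv.Perm (Fin b), φ (s c)
        = ∑ c' : Fin b, ∑ s : Equiv.Perm (Fin b), φ (s c') := by
          simp_rw [hc]; simp
      _ = ∑ s : Equiv.Perm (Fin b), ∑ c' : Fin b, φ (s c') := Finset.sum_comm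
      _ = ∑ s : Equiv.Perm (Fin b), ∑ d, φ d :=
          Finset.sum_congr rfl fun s _ => Equiv.sum_comp s φ
      _ = _ := by simp [Fintype.card_perm]
  have hb' : (b : ℂ) ≠ 0 := by exact_mod_cast hb
  have hf : (b.factorial : ℂ) ≠ 0 := by exact_mod_cast b.factorial_ne_zero
  field_simp
  linear_combination h1

/-- Integrating out digits that are independent of each other and of the past. -/
theorem integral_prod_of_indepFun {Ω ι : Type*} [MeasurableSpace Ω] {P : Measure Ω}
    [IsProbabilityMeasure P] [Fintype ι] {b : ℕ} {Y : ι → Ω → ℝ} {W : ι → Ω → Fin b}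
    (hY : ∀ i, Measurable (Y i)) (hW : ∀ i, Measurable (W i))
    (hYW : IndepFun (fun ω i => Y i ω) (fun ω i => W i ω) P) (hWi : iIndepFun W P)
    {Φ : ℝ → Fin b → ℂ} (hΦ : ∀ d, Continuous fun y => Φ y d) (hb : ∀ y d, ‖Φ y d‖ ≤ 1) :
    ∫ ω, ∏ i, Φ (Y i ω) (W i ω) ∂P = ∫ ω, ∏ i, ∫ ω', Φ (Y i ω) (W i ω') ∂P ∂P := by
  have hYm : Measurable fun ω i => Y i ω := measurable_pi_lambda _ hY
  have hWm : Measurable fun ω i => W i ω := measurable_pi_lambda _ hW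
  have hΦm : Measurable fun z : ℝ × Fin b => Φ z.1 z.2 :=
    measurable_from_prod_countable_left fun d => (hΦ d).measurable
  have hFm : Measurable fun z : (ι → ℝ) × (ι → Fin b) => ∏ i, Φ (z.1 i) (z.2 i) := by
    refine Finset.measurable_prod _ fun i _ => ?_
    have hpair : Measurable fun z : (ι → ℝ) × (ι → Fin b) => (z.1 i, z.2 i) := by fun_prop
    exact hΦm.comp hpair
  have hprob1 : IsProbabilityMeasure (P.map fun ω i => Y i ω) :=
    Measure.isProbabilityMeasure_map hYm.aemeasurable
  have hprob2 : ∀ i, IsProbabilityMeasure (P.map (W i)) := fun i =>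
    Measure.isProbabilityMeasure_map (hW i).aemeasurable
  have hmap := (indepFun_iff_map_prod_eq_prod_map_map hYm.aemeasurable hWm.aemeasurable).1 hYW
  have hpi := (iIndepFun_iff_map_fun_eq_pi_map fun i => (hW i).aemeasurable).1 hWi
  calc ∫ ω, ∏ i, Φ (Y i ω) (W i ω) ∂P
      = ∫ z, ∏ i, Φ (z.1 i) (z.2 i) ∂(P.map fun ω => ((fun i => Y i ω), fun i => W i ω)) := by
        rw [integral_map (hYm.prodMk hWm).aemeasurable hFm.aestronglyMeasurable]
    _ = ∫ y, ∫ w, ∏ i, Φ (y i) (w i) ∂(Measure.pi fun i => P.map (W i))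
          ∂(P.map fun ω i => Y i ω) := by
        rw [hmap, hpi, integral_prod]
        refine Integrable.of_bound hFm.aestronglyMeasurable 1 (ae_of_all _ fun z => ?_)
        rw [norm_prod]
        exact Finset.prod_le_one (fun _ _ => norm_nonneg _) fun i _ => hb _ _
    _ = ∫ y, ∏ i, ∫ ω', Φ (y i) (W i ω') ∂P ∂(P.map fun ω i => Y i ω) := by
        refine integral_congr_ae (ae_of_all _ fun y => ?_)
        simp only
        rw [integral_fintype_prod_eq_prod]
        refine Finset.prod_congr rfl fun i _ => ?_
        rw [integral_map (hW i).aemeasurable (measurable_of_countable _).aestronglyMeasurable]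
    _ = _ := by
        rw [integral_map hYm.aemeasurable]
        refine Measurable.aestronglyMeasurable ?_
        refine Finset.measurable_prod _ fun i _ => ?_
        have hcont : Continuous fun y => ∫ ω', Φ y (W i ω') ∂P := by
          refine continuous_of_dominated (bound := fun _ => 1) (fun y => ?_) (fun y => ?_)
            (integrable_const _) (ae_of_all _ fun ω' => hΦ _)
          · exact ((measurable_of_countable (Φ y)).comp (hW i)).aestronglyMeasurable
          · exact ae_of_all _ fun ω' => hb _ _
        exact hcont.measurable.comp (measurable_pi_apply i)

end PermTree

/-! ### The product formula for scrambled nets -/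

section Scrambling

variable {Ω : Type*} [MeasurableSpace Ω] {P : Measure Ω} {b : ℕ}

/-- The string of the first `k` digits. -/
def digitPrefix (α : ℕ → Fin b) (k : ℕ) : List (Fin b) := List.ofFn fun i : Fin k => α i

/-- The digits of the scrambled point. -/
def scrambledDigits (p : List (Fin b) → Equiv.Perm (Fin b)) (α : ℕ → Fin b) : ℕ → Fin b :=
  fun k => p (digitPrefix α k) (α k)

/-- The scrambled point, truncated after `k` digits. -/
noncomputable def scrambledTrunc (p : List (Fin b) → Equiv.Perm (Fin b)) (α : ℕ → Fin b)
    (k : ℕ) : ℝ :=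
  ∑ q ∈ Finset.range k, Real.ofDigitsTerm (scrambledDigits p α) q

theorem length_digitPrefix (α : ℕ → Fin b) (k : ℕ) : (digitPrefix α k).length = k := by
  simp [digitPrefix]

theorem digitPrefix_eq_iff {α α' : ℕ → Fin b} {k : ℕ} :
    digitPrefix α k = digitPrefix α' k ↔ ∀ q < k, α q = α' q := by
  rw [digitPrefix, digitPrefix, List.ofFn_inj, funext_iff]
  exact ⟨fun h q hq => h ⟨q, hq⟩, fun h q => h q q.2⟩

/-- Digits are recovered one by one: once the earlier digits agree, the same permutation acts on the
next digit, and it is injective. -/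
theorem scrambledDigits_injective {p : List (Fin b) → Equiv.Perm (Fin b)} {α α' : ℕ → Fin b}
    {m : ℕ} (h : ∀ q < m, scrambledDigits p α q = scrambledDigits p α' q) :
    ∀ q < m, α q = α' q := by
  intro q
  induction q using Nat.strong_induction_on with
  | _ q ih =>
    intro hq
    have h1 := h q hq
    have h2 : digitPrefix α q = digitPrefix α' q :=
      digitPrefix_eq_iff.2 fun q' hq' => ih q' hq' (hq'.trans hq)
    rw [scrambledDigits, scrambledDigits, h2] at h1
    exact (p _).injective h1

theorem IsUniformPermTree.measurable_apply {p : List (Fin b) → Ω → Equiv.Perm (Fin b)}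
    (hp : IsUniformPermTree P p) (l : List (Fin b)) (c : Fin b) :
    Measurable fun ω => p l ω c := by
  refine measurable_to_countable' fun d => ?_
  have : (fun ω => p l ω c) ⁻¹' {d} = ⋃ s ∈ {s : Equiv.Perm (Fin b) | s c = d}, p l ⁻¹' {s} := by
    ext ω
    simp
  rw [this]
  exact MeasurableSet.biUnion (Set.to_countable _) fun s _ => hp.meas l s

theorem IsUniformPermTree.integral_apply [IsProbabilityMeasure P] (hb : b ≠ 0)
    {p : List (Fin b) → Ω → Equiv.Perm (Fin b)} (hp : IsUniformPermTree P p) (l : List (Fin b))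
    (c : Fin b) (φ : Fin b → ℂ) :
    ∫ ω, φ (p l ω c) ∂P = (b : ℂ)⁻¹ * ∑ d, φ d := by
  let _ : MeasurableSpace (Equiv.Perm (Fin b)) := ⊤
  have hm : Measurable (p l) := measurable_to_countable' (hp.meas l)
  have : IsProbabilityMeasure (P.map (p l)) := Measure.isProbabilityMeasure_map hm.aemeasurable
  rw [← sum_perm_apply hb φ c,
    ← integral_map (f := fun s : Equiv.Perm (Fin b) => φ (s c)) hm.aemeasurable
      (measurable_of_countable _).aestronglyMeasurable, integral_fintype (Integrable.of_finite),
    Finset.mul_sum]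
  refine Finset.sum_congr rfl fun s _ => ?_
  rw [map_measureReal_apply hm (measurableSet_singleton _), measureReal_def, hp.uniform]
  simp

theorem IsUniformPermTree.measurable_scrambledTrunc {p : List (Fin b) → Ω → Equiv.Perm (Fin b)}
    (hp : IsUniformPermTree P p) (α : ℕ → Fin b) (k : ℕ) :
    Measurable fun ω => scrambledTrunc (fun l => p l ω) α k := by
  refine Finset.measurable_sum _ fun q _ => ?_
  exact (measurable_of_countable fun d : Fin b => ((d : ℕ) : ℝ) * ((b : ℝ) ^ (q + 1))⁻¹).comp
    (hp.measurable_apply _ _)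

/-- The first `k` scrambled digits use permutations attached to strings of length less than `k`, the
next digit those attached to strings of length exactly `k`. These are disjoint subfamilies. -/
theorem IsUniformPermTree.indepFun_trunc {ι : Type*} [Fintype ι]
    {p : List (Fin b) → Ω → Equiv.Perm (Fin b)}
    (hp : IsUniformPermTree P p) (α : ι → ℕ → Fin b) (k : ℕ) :
    IndepFun (fun ω i => scrambledTrunc (fun l => p l ω) (α i) k)
      (fun ω i => p (digitPrefix (α i) k) ω (α i k)) P := by
  classical
  let _ : MeasurableSpace (Equiv.Perm (Fin b)) := ⊤
  let S : Finset (List (Fin b)) :=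
    (Finset.univ ×ˢ Finset.range k).image fun z : ι × ℕ => digitPrefix (α z.1) z.2
  let T : Finset (List (Fin b)) := Finset.univ.image fun i : ι => digitPrefix (α i) k
  have hST : Disjoint S T := by
    rw [Finset.disjoint_left]
    intro l hS hT
    obtain ⟨z, hz, rfl⟩ := Finset.mem_image.1 hS
    obtain ⟨i, -, hi⟩ := Finset.mem_image.1 hT
    have h := congrArg List.length hi
    rw [length_digitPrefix, length_digitPrefix] at h
    have h2 := (Finset.mem_product.1 hz).2
    rw [Finset.mem_range] at h2
    omega
  have hSm : ∀ (i : ι) (q : ℕ), q < k → digitPrefix (α i) q ∈ S := fun i q hq =>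
    Finset.mem_image.2 ⟨(i, q), by simp [hq], rfl⟩
  have hTm : ∀ i : ι, digitPrefix (α i) k ∈ T := fun i =>
    Finset.mem_image.2 ⟨i, Finset.mem_univ _, rfl⟩
  have hind := hp.indep.indepFun_finset S T hST fun l => measurable_to_countable' (hp.meas l)
  let φ : (S → Equiv.Perm (Fin b)) → ι → ℝ := fun s i =>
    ∑ q ∈ (Finset.range k).attach,
      ((s ⟨digitPrefix (α i) q, hSm i q (Finset.mem_range.1 q.2)⟩ (α i q) : ℕ) : ℝ) *
        ((b : ℝ) ^ ((q : ℕ) + 1))⁻¹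
  let ψ : (T → Equiv.Perm (Fin b)) → ι → Fin b := fun s i => s ⟨digitPrefix (α i) k, hTm i⟩ (α i k)
  have hφ : Measurable φ := measurable_of_countable _
  have hψ : Measurable ψ := measurable_of_countable _
  have h := hind.comp hφ hψ
  convert! h using 1
  ext ω i
  simp only [scrambledTrunc, Real.ofDigitsTerm, scrambledDigits, Function.comp_apply, φ]
  rw [Finset.sum_attach (Finset.range k) fun q =>
    ((p (digitPrefix (α i) q) ω (α i q) : ℕ) : ℝ) * ((b : ℝ) ^ (q + 1))⁻¹]

theorem IsUniformPermTree.iIndepFun_digit {ι : Type*}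
    {p : List (Fin b) → Ω → Equiv.Perm (Fin b)}
    (hp : IsUniformPermTree P p) (α : ι → ℕ → Fin b) (k : ℕ)
    (hα : Function.Injective fun i => digitPrefix (α i) k) :
    iIndepFun (fun i ω => p (digitPrefix (α i) k) ω (α i k)) P :=
  (hp.indep.precomp hα).comp (mγ := fun _ => inferInstance)
    (fun i (s : Equiv.Perm (Fin b)) => s (α i k)) fun _ => measurable_from_top

/-- Given the first `k` digits of all points, the next digits are independent and uniform because
the prefixes differ. Averaging over such a digit merges `b` intervals of length `b^(-k-1)` into one
of length `b^(-k)`. -/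
theorem IsUniformPermTree.integral_prod_blockAverage_succ [IsProbabilityMeasure P] {ι : Type*}
    [Fintype ι] (hb : b ≠ 0) {p : List (Fin b) → Ω → Equiv.Perm (Fin b)}
    (hp : IsUniformPermTree P p) (α : ι → ℕ → Fin b) (k : ℕ)
    (hα : Function.Injective fun i => digitPrefix (α i) k) {g : ℝ → ℂ} (hg : Continuous g)
    (hg1 : ∀ x, ‖g x‖ ≤ 1) :
    ∫ ω, ∏ i, blockAverage g ((b : ℝ) ^ (k + 1))⁻¹
        (scrambledTrunc (fun l => p l ω) (α i) (k + 1)) ∂P =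
      ∫ ω, ∏ i, blockAverage g ((b : ℝ) ^ k)⁻¹ (scrambledTrunc (fun l => p l ω) (α i) k) ∂P := by
  have hbR : (b : ℝ) ≠ 0 := by exact_mod_cast hb
  have h := integral_prod_of_indepFun (P := P)
    (Y := fun i ω => scrambledTrunc (fun l => p l ω) (α i) k)
    (W := fun i ω => p (digitPrefix (α i) k) ω (α i k))
    (fun i => hp.measurable_scrambledTrunc _ _) (fun i => hp.measurable_apply _ _)
    (hp.indepFun_trunc α k) (hp.iIndepFun_digit α k hα)
    (Φ := fun y d => blockAverage g ((b : ℝ) ^ (k + 1))⁻¹ (y + d * ((b : ℝ) ^ (k + 1))⁻¹))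
    (fun d => (continuous_blockAverage hg).comp
      (continuous_const.prodMk (by fun_prop : Continuous fun y : ℝ => _)))
    (fun y d => norm_blockAverage_le hg1 _ _)
  have hδ : (b : ℝ) * ((b : ℝ) ^ (k + 1))⁻¹ = ((b : ℝ) ^ k)⁻¹ := by
    rw [pow_succ]; field_simp
  have hint : ∀ (i : ι) (y : ℝ), ∫ ω', blockAverage g ((b : ℝ) ^ (k + 1))⁻¹
      (y + (p (digitPrefix (α i) k) ω' (α i k) : ℕ) * ((b : ℝ) ^ (k + 1))⁻¹) ∂P =
        blockAverage g ((b : ℝ) ^ k)⁻¹ y := fun i y => by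
    rw [hp.integral_apply hb (digitPrefix (α i) k) (α i k)
      fun d => blockAverage g ((b : ℝ) ^ (k + 1))⁻¹ (y + (d : ℕ) * ((b : ℝ) ^ (k + 1))⁻¹),
      inv_mul_sum_blockAverage hg hb (by positivity), hδ]
  simp_rw [hint] at h
  rw [← h]
  simp_rw [scrambledTrunc, Finset.sum_range_succ]
  rfl

theorem prod_fin_function_eq (b m : ℕ) (G : ℝ → ℂ) (hb : b ≠ 0) :
    ∏ w : Fin m → Fin b, G (∑ q : Fin m, ((w q : ℕ) : ℝ) * ((b : ℝ) ^ ((q : ℕ) + 1))⁻¹) =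
      ∏ j : Fin (b ^ m), G ((j : ℝ) / (b : ℝ) ^ m) := by
  have hbR : (b : ℝ) ≠ 0 := by exact_mod_cast hb
  -- The order of the digits is reversed because `finFunctionFinEquiv` takes the least significant
  -- digit first.
  refine Fintype.prod_equiv ((Equiv.arrowCongr Fin.revPerm (Equiv.refl _)).trans
    finFunctionFinEquiv) _ _ fun w => ?_
  congr 1
  simp only [Equiv.trans_apply, finFunctionFinEquiv_apply]
  push_cast
  rw [Finset.sum_div, ← Equiv.sum_comp Fin.revPerm]
  refine Finset.sum_congr rfl fun q _ => ?_
  simp only [Equiv.arrowCongr_apply, Function.comp_apply, Equiv.refl_apply, Fin.revPerm_apply,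
    Fin.revPerm_symm, Fin.val_rev]
  rw [mul_div_assoc]
  congr 1
  have hm : (b : ℝ) ^ m = (b : ℝ) ^ (m - ((q : ℕ) + 1) + 1) * (b : ℝ) ^ (q : ℕ) := by
    rw [← pow_add]
    congr 1
    omega
  rw [hm]
  field_simp

/-- For every realisation, scrambling is a bijection on prefixes of length `m`, so the truncated
points are exactly the left end points of the strata. The product is therefore not random. -/
theorem prod_scrambledTrunc (hb : b ≠ 0) {m : ℕ} (p : List (Fin b) → Equiv.Perm (Fin b))
    (α : Fin (b ^ m) → ℕ → Fin b) (hα : ∀ i i', (∀ q < m, α i q = α i' q) → i = i')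
    (G : ℝ → ℂ) :
    ∏ i, G (scrambledTrunc p (α i) m) = ∏ j : Fin (b ^ m), G ((j : ℝ) / (b : ℝ) ^ m) := by
  rw [← prod_fin_function_eq b m G hb]
  have hinj : Function.Injective fun (i : Fin (b ^ m)) (q : Fin m) =>
      scrambledDigits p (α i) q := fun i i' h =>
    hα i i' (scrambledDigits_injective fun q hq => congrFun h ⟨q, hq⟩)
  have hbij := (Fintype.bijective_iff_injective_and_card _).2 ⟨hinj, by simp⟩
  refine Fintype.prod_bijective _ hbij _ _ fun i => ?_
  rw [scrambledTrunc, ← Fin.sum_univ_eq_sum_range]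
  rfl

/-- The first `m` digits determine `⌊b^m a⌋`, hence the stratum, which contains a single net point.
-/
theorem IsNet.digits_injective [NeZero b] {m : ℕ} {a : Fin (b ^ m) → ℝ} (ha : IsNet b m a)
    (i i' : Fin (b ^ m)) (h : ∀ q < m, Real.digits (a i) b q = Real.digits (a i') b q) :
    i = i' := by
  have hb0 : (0 : ℝ) < b := by exact_mod_cast NeZero.pos b
  have hpow : (0 : ℝ) < (b : ℝ) ^ m := by positivity
  have hfl : ⌊(b : ℝ) ^ m * a i⌋₊ = ⌊(b : ℝ) ^ m * a i'⌋₊ := by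
    have h1 := Real.ofDigits_digits_sum_eq (b := b) (ha.1 i) m
    have h2 := Real.ofDigits_digits_sum_eq (b := b) (ha.1 i') m
    have h3 : ∑ q ∈ Finset.range m, Real.ofDigitsTerm (Real.digits (a i) b) q =
        ∑ q ∈ Finset.range m, Real.ofDigitsTerm (Real.digits (a i') b) q :=
      Finset.sum_congr rfl fun q hq => by
        simp [Real.ofDigitsTerm, h q (Finset.mem_range.1 hq)]
    rw [h3, h2] at h1
    exact_mod_cast h1.symm
  have hmem : ∀ i, a i ∈ Set.Ico ((⌊(b : ℝ) ^ m * a i⌋₊ : ℝ) / (b : ℝ) ^ m)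
      (((⌊(b : ℝ) ^ m * a i⌋₊ : ℝ) + 1) / (b : ℝ) ^ m) := fun i => by
    have h0 : 0 ≤ (b : ℝ) ^ m * a i := mul_nonneg hpow.le (ha.1 i).1
    constructor
    · rw [div_le_iff₀' hpow]
      exact Nat.floor_le h0
    · rw [lt_div_iff₀' hpow]
      exact Nat.lt_floor_add_one _
  have hlt : ⌊(b : ℝ) ^ m * a i⌋₊ < b ^ m := by
    rw [Nat.floor_lt (mul_nonneg hpow.le (ha.1 i).1)]
    push_cast
    exact mul_lt_of_lt_one_right hpow (ha.1 i).2
  have h1 := hmem i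
  have h2 := hmem i'
  rw [← hfl] at h2
  exact (ha.2 ⟨_, hlt⟩).unique h1 h2

theorem nestedScramble_eq [NeZero b] (p : List (Fin b) → Equiv.Perm (Fin b)) (a : ℝ) :
    nestedScramble p a = Real.ofDigits (scrambledDigits p (Real.digits a b)) := rfl

theorem tendsto_scrambledTrunc (p : List (Fin b) → Equiv.Perm (Fin b)) (α : ℕ → Fin b) :
    Tendsto (scrambledTrunc p α) atTop (𝓝 (Real.ofDigits (scrambledDigits p α))) :=
  Real.summable_ofDigitsTerm.hasSum.tendsto_sum_nat

variable [NeZero b] {m : ℕ} {X : Fin (b ^ m) → Ω → ℝ}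

theorem IsNestedScrambledNet.mem (hX : IsNestedScrambledNet P b m X) (i : Fin (b ^ m)) (ω : Ω) :
    X i ω ∈ Set.Icc (0 : ℝ) 1 := by
  obtain ⟨a, -, p, -, hXp⟩ := hX
  rw [hXp, nestedScramble_eq]
  exact ⟨Real.ofDigits_nonneg _, Real.ofDigits_le_one _⟩

theorem IsNestedScrambledNet.measurable (hX : IsNestedScrambledNet P b m X) (i : Fin (b ^ m)) :
    Measurable (X i) := by
  obtain ⟨a, -, p, hp, hXp⟩ := hX
  refine measurable_of_tendsto_metrizable
    (f := fun k ω => scrambledTrunc (fun l => p l ω) (Real.digits (a i) b) k)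
    (fun k => hp.measurable_scrambledTrunc _ k) ?_
  rw [tendsto_pi_nhds]
  intro ω
  rw [hXp, nestedScramble_eq]
  exact tendsto_scrambledTrunc _ _

/-- The quantity `J k` is constant for `k ≥ m`. At `k = m` it is the deterministic product over
strata; as `k → ∞` the intervals shrink to the scrambled points and it tends to the expectation on
the left. -/
theorem IsNestedScrambledNet.integral_prod [IsProbabilityMeasure P] (hb : 2 ≤ b)
    (hX : IsNestedScrambledNet P b m X) {g : ℝ → ℂ} (hg : Continuous g) (hg1 : ∀ x, ‖g x‖ ≤ 1) :
    ∫ ω, ∏ i, g (X i ω) ∂P =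
      ∏ j : Fin (b ^ m), blockAverage g ((b : ℝ) ^ m)⁻¹ ((j : ℝ) / (b : ℝ) ^ m) := by
  obtain ⟨a, ha, p, hp, hXp⟩ := hX
  have hb0 : b ≠ 0 := by omega
  set α : Fin (b ^ m) → ℕ → Fin b := fun i => Real.digits (a i) b with hα
  set J : ℕ → ℂ := fun k => ∫ ω, ∏ i, blockAverage g ((b : ℝ) ^ k)⁻¹
    (scrambledTrunc (fun l => p l ω) (α i) k) ∂P with hJ
  have hconst : ∀ n, J (m + n) = J m := fun n => by
    induction n with
    | zero => rfl
    | succ n ih =>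
      rw [← ih]
      refine hp.integral_prod_blockAverage_succ hb0 α (m + n) (fun i i' h => ?_) hg hg1
      refine ha.digits_injective i i' fun q hq => ?_
      exact digitPrefix_eq_iff.1 h q (by omega)
  have hJm : J m = ∏ j : Fin (b ^ m), blockAverage g ((b : ℝ) ^ m)⁻¹ ((j : ℝ) / (b : ℝ) ^ m) := by
    simp only [hJ]
    simp_rw [prod_scrambledTrunc hb0 _ α ha.digits_injective]
    simp
  have hlim : Tendsto (fun n => J (m + n)) atTop (𝓝 (∫ ω, ∏ i, g (X i ω) ∂P)) := by
    refine tendsto_integral_of_dominated_convergence (fun _ => 1) (fun n => ?_)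
      (integrable_const _) (fun n => ae_of_all _ fun ω => ?_) (ae_of_all _ fun ω => ?_)
    · refine Measurable.aestronglyMeasurable (Finset.measurable_prod _ fun i _ => ?_)
      exact ((continuous_blockAverage hg).comp
        (continuous_const.prodMk continuous_id)).measurable.comp
          (hp.measurable_scrambledTrunc (α i) (m + n))
    · rw [norm_prod]
      exact Finset.prod_le_one (fun _ _ => norm_nonneg _) fun i _ => norm_blockAverage_le hg1 _ _
    · refine tendsto_finsetProd _ fun i _ => ?_
      have hmn : Tendsto (fun n => m + n) atTop atTop := 
        tendsto_atTop_mono (fun n => Nat.le_add_left n m) tendsto_id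
      have h1 : Tendsto (fun n => ((b : ℝ) ^ (m + n))⁻¹) atTop (𝓝 0) := by
        refine Tendsto.inv_tendsto_atTop ?_
        exact (tendsto_pow_atTop_atTop_of_one_lt (by exact_mod_cast hb)).comp hmn
      have h2 := (tendsto_scrambledTrunc (fun l => p l ω) (α i)).comp hmn
      have h3 := ((continuous_blockAverage hg).tendsto
        (0, Real.ofDigits (scrambledDigits (fun l => p l ω) (α i)))).comp (h1.prodMk_nhds h2)
      rw [blockAverage_zero] at h3
      rw [hXp, nestedScramble_eq]
      exact h3
  simp_rw [hconst, hJm] at hlim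
  exact tendsto_nhds_unique tendsto_const_nhds hlim |>.symm

end Scrambling

/-! ### Local expansion of the integrand on a stratum -/

section Strata

/-- The extension of a function on `[0,1]` to `ℝ` that is constant outside `[0,1]`. -/
noncomputable def clampExtend (h : ℝ → ℝ) (x : ℝ) : ℝ := h (max 0 (min 1 x))

theorem clampExtend_of_mem (h : ℝ → ℝ) {x : ℝ} (hx : x ∈ Set.Icc (0 : ℝ) 1) :
    clampExtend h x = h x := by
  rw [clampExtend, min_eq_right hx.2, max_eq_right hx.1]

/-- Nothing is known about `f` outside `[0,1]`, whereas the product formulas are applied to test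
functions continuous on all of `ℝ`. -/
theorem continuous_clampExtend {h : ℝ → ℝ} (hh : ContinuousOn h (Set.Icc 0 1)) :
    Continuous (clampExtend h) :=
  hh.comp_continuous (by fun_prop) fun x => ⟨le_max_left _ _, max_le zero_le_one (min_le_left _ _)⟩

theorem LipschitzDerivative.exists_bounds {β : ℝ≥0} {f : ℝ → ℝ}
    (hf : LipschitzDerivative β f) :
    ∃ C M : ℝ, 0 ≤ C ∧ 0 ≤ M ∧
      (∀ x ∈ Set.Icc (0 : ℝ) 1, ∀ y ∈ Set.Icc (0 : ℝ) 1,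
        |derivWithin f (Set.Icc 0 1) x - derivWithin f (Set.Icc 0 1) y| ≤
          C * |x - y| ^ (β : ℝ)) ∧
      ∀ x ∈ Set.Icc (0 : ℝ) 1, |derivWithin f (Set.Icc 0 1) x| ≤ M := by
  obtain ⟨-, C, hC⟩ := hf
  have h1 : ∀ x ∈ Set.Icc (0 : ℝ) 1, ∀ y ∈ Set.Icc (0 : ℝ) 1,
      |derivWithin f (Set.Icc 0 1) x - derivWithin f (Set.Icc 0 1) y| ≤
        C * |x - y| ^ (β : ℝ) := fun x hx y hy => by
    have := hC.dist_le hx hy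
    rwa [Real.dist_eq, Real.dist_eq] at this
  refine ⟨C, |derivWithin f (Set.Icc 0 1) 0| + C, C.2, by positivity, h1, fun x hx => ?_⟩
  have h2 := h1 x hx 0 ⟨le_rfl, zero_le_one⟩
  have h3 : |x - 0| ^ (β : ℝ) ≤ 1 := by
    refine Real.rpow_le_one (abs_nonneg _) ?_ β.2
    rw [sub_zero, abs_of_nonneg hx.1]
    exact hx.2
  have h4 := abs_sub_abs_le_abs_sub (derivWithin f (Set.Icc 0 1) x) (derivWithin f (Set.Icc 0 1) 0)
  have h5 : (C : ℝ) * |x - 0| ^ (β : ℝ) ≤ C := mul_le_of_le_one_right C.2 h3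
  linarith

theorem LipschitzDerivative.continuousOn_derivWithin {β : ℝ≥0} {f : ℝ → ℝ}
    (hf : LipschitzDerivative β f) (hβ : 0 < β) :
    ContinuousOn (derivWithin f (Set.Icc 0 1)) (Set.Icc 0 1) := by
  obtain ⟨-, C, hC⟩ := hf
  exact hC.continuousOn hβ

/-- The variance of a uniform variable is the origin of the factor `1/12` in `sigmaSq`. -/
theorem integral_linear_sq (c : ℝ) :
    ∫ u in (0 : ℝ)..1, (c * (u - 1 / 2)) ^ 2 = c ^ 2 / 12 := by
  simp_rw [mul_pow]
  rw [intervalIntegral.integral_const_mul,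
    intervalIntegral.integral_comp_sub_right (fun x : ℝ => x ^ 2), integral_pow]
  norm_num
  ring

variable {f : ℝ → ℝ} {β C M : ℝ}

/-- First order Taylor expansion at `s` on a short interval. -/
theorem abs_sub_linear_le (hd : DifferentiableOn ℝ f (Set.Icc 0 1))
    (hC0 : 0 ≤ C) (hβ : 0 ≤ β)
    (hC : ∀ x ∈ Set.Icc (0 : ℝ) 1, ∀ y ∈ Set.Icc (0 : ℝ) 1,
      |derivWithin f (Set.Icc 0 1) x - derivWithin f (Set.Icc 0 1) y| ≤ C * |x - y| ^ β)
    {s δ u : ℝ} (hs : 0 ≤ s) (hδ : 0 ≤ δ) (hsδ : s + δ ≤ 1) (hu : u ∈ Set.Icc (0 : ℝ) 1) :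
    |f (s + δ * u) - (f s + derivWithin f (Set.Icc 0 1) s * (δ * u))| ≤ C * δ ^ β * δ := by
  set g := derivWithin f (Set.Icc 0 1) with hg
  have hsub : Set.Icc s (s + δ) ⊆ Set.Icc 0 1 := Set.Icc_subset_Icc hs hsδ
  have hsmem : s ∈ Set.Icc s (s + δ) := ⟨le_rfl, by linarith⟩
  have hδu : δ * u ≤ δ := mul_le_of_le_one_right hδ hu.2
  have hδu0 : 0 ≤ δ * u := mul_nonneg hδ hu.1
  have hderiv : ∀ x ∈ Set.Icc s (s + δ),
      HasDerivWithinAt (fun x => f x - g s * x) (g x - g s) (Set.Icc s (s + δ)) x := fun x hx => by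
    have h1 := ((hd x (hsub hx)).hasDerivWithinAt).mono hsub
    have h2 := (hasDerivWithinAt_id x (Set.Icc s (s + δ))).const_mul (g s)
    rw [mul_one] at h2
    exact h1.sub h2
  -- Mean value inequality for `f x - g s * x`, whose derivative `g x - g s` is at most `C δ^β` on
  -- the interval.
  have h := (convex_Icc s (s + δ)).norm_image_sub_le_of_norm_hasDerivWithin_le (C := C * δ ^ β)
    hderiv (fun x hx => by
      rw [Real.norm_eq_abs]
      refine (hC x (hsub hx) s (hsub hsmem)).trans ?_
      gcongr
      rw [abs_of_nonneg (by linarith [hx.1])]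
      linarith [hx.2]) hsmem (y := s + δ * u) ⟨by linarith, by linarith⟩
  rw [Real.norm_eq_abs, Real.norm_eq_abs, add_sub_cancel_left, abs_of_nonneg hδu0] at h
  calc _ = |f (s + δ * u) - g s * (s + δ * u) - (f s - g s * s)| := by congr 1; ring
    _ ≤ C * δ ^ β * (δ * u) := h
    _ ≤ _ := by gcongr

/-- The rescaled fluctuation of `F` on the stratum `[s, s + δ]`. -/
noncomputable def stratumFluctuation (F : ℝ → ℝ) (δ s u : ℝ) : ℝ :=
  δ⁻¹ * (F (s + δ * u) - blockAverage F δ s)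

theorem continuous_stratumFluctuation {F : ℝ → ℝ} (hF : Continuous F) (δ s : ℝ) :
    Continuous (stratumFluctuation F δ s) := by
  unfold stratumFluctuation; fun_prop

theorem integral_stratumFluctuation {F : ℝ → ℝ} (hF : Continuous F) (δ s : ℝ) :
    ∫ u in (0 : ℝ)..1, stratumFluctuation F δ s u = 0 := by
  unfold stratumFluctuation
  rw [intervalIntegral.integral_const_mul, intervalIntegral.integral_sub
    ((by fun_prop : Continuous fun u => F (s + δ * u)).intervalIntegrable _ _) (by simp)]
  simp [blockAverage]

theorem abs_intervalIntegral_le {h : ℝ → ℝ} {K : ℝ} (hh : ∀ u ∈ Set.Icc (0 : ℝ) 1, |h u| ≤ K) :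
    |∫ u in (0 : ℝ)..1, h u| ≤ K := by
  have := intervalIntegral.norm_integral_le_of_norm_le_const (a := 0) (b := 1) (C := K) (f := h)
    fun u hu => by
      rw [Set.uIoc_of_le zero_le_one] at hu
      exact hh u ⟨hu.1.le, hu.2⟩
  simpa using this

/-- The value of `f` and its stratum average each differ from those of the Taylor polynomial by at
most `C δ^β δ`; the centred polynomial divided by `δ` is `f'(s) (u - 1/2)`. -/
theorem abs_stratumFluctuation_sub_le (hd : DifferentiableOn ℝ f (Set.Icc 0 1))
    (hC0 : 0 ≤ C) (hβ : 0 ≤ β)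
    (hC : ∀ x ∈ Set.Icc (0 : ℝ) 1, ∀ y ∈ Set.Icc (0 : ℝ) 1,
      |derivWithin f (Set.Icc 0 1) x - derivWithin f (Set.Icc 0 1) y| ≤ C * |x - y| ^ β)
    {s δ u : ℝ} (hs : 0 ≤ s) (hδ : 0 < δ) (hsδ : s + δ ≤ 1) (hu : u ∈ Set.Icc (0 : ℝ) 1) :
    |stratumFluctuation (clampExtend f) δ s u - derivWithin f (Set.Icc 0 1) s * (u - 1 / 2)| ≤
      2 * C * δ ^ β := by
  set g := derivWithin f (Set.Icc 0 1) with hg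
  have hF := continuous_clampExtend hd.continuousOn
  have hR : ∀ u ∈ Set.Icc (0 : ℝ) 1,
      |clampExtend f (s + δ * u) - (f s + g s * (δ * u))| ≤ C * δ ^ β * δ := fun u hu => by
    have h1 : δ * u ≤ δ := mul_le_of_le_one_right hδ.le hu.2
    have h0 : 0 ≤ δ * u := mul_nonneg hδ.le hu.1
    rw [clampExtend_of_mem f ⟨by linarith, by linarith⟩]
    exact abs_sub_linear_le hd hC0 hβ hC hs hδ.le hsδ hu
  have hA : |blockAverage (clampExtend f) δ s - (f s + g s * δ / 2)| ≤ C * δ ^ β * δ := by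
    have h := abs_intervalIntegral_le hR
    rw [intervalIntegral.integral_sub
      ((by fun_prop : Continuous fun u => clampExtend f (s + δ * u)).intervalIntegrable _ _)
      ((by fun_prop : Continuous fun u => f s + g s * (δ * u)).intervalIntegrable _ _)] at h
    have h2 : ∫ u in (0 : ℝ)..1, (f s + g s * (δ * u)) = f s + g s * δ / 2 := by
      rw [intervalIntegral.integral_add (by simp)
        ((by fun_prop : Continuous fun u => g s * (δ * u)).intervalIntegrable _ _),
        intervalIntegral.integral_const_mul, intervalIntegral.integral_const_mul, integral_id]
      simp
      ring
    rw [h2] at h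
    exact h
  have e : stratumFluctuation (clampExtend f) δ s u - g s * (u - 1 / 2) =
      δ⁻¹ * ((clampExtend f (s + δ * u) - (f s + g s * (δ * u))) -
        (blockAverage (clampExtend f) δ s - (f s + g s * δ / 2))) := by
    unfold stratumFluctuation
    field_simp
    ring
  rw [e, abs_mul, abs_of_pos (inv_pos.2 hδ), inv_mul_le_iff₀ hδ]
  refine (abs_sub _ _).trans ?_
  linarith [hR u hu]

theorem abs_stratumFluctuation_le (hd : DifferentiableOn ℝ f (Set.Icc 0 1))
    (hC0 : 0 ≤ C) (hβ : 0 ≤ β)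
    (hC : ∀ x ∈ Set.Icc (0 : ℝ) 1, ∀ y ∈ Set.Icc (0 : ℝ) 1,
      |derivWithin f (Set.Icc 0 1) x - derivWithin f (Set.Icc 0 1) y| ≤ C * |x - y| ^ β)
    (hM : ∀ x ∈ Set.Icc (0 : ℝ) 1, |derivWithin f (Set.Icc 0 1) x| ≤ M)
    {s δ u : ℝ} (hs : 0 ≤ s) (hδ : 0 < δ) (hsδ : s + δ ≤ 1) (hu : u ∈ Set.Icc (0 : ℝ) 1) :
    |stratumFluctuation (clampExtend f) δ s u| ≤ M + 2 * C := by
  have h1 := abs_stratumFluctuation_sub_le hd hC0 hβ hC hs hδ hsδ hu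
  have h2 : |derivWithin f (Set.Icc 0 1) s * (u - 1 / 2)| ≤ M := by
    rw [abs_mul]
    have h3 : |u - 1 / 2| ≤ 1 := by rw [abs_le]; constructor <;> linarith [hu.1, hu.2]
    calc _ ≤ |derivWithin f (Set.Icc 0 1) s| * 1 := by gcongr
      _ ≤ M := by rw [mul_one]; exact hM s ⟨hs, by linarith⟩
  have h4 : δ ^ β ≤ 1 := Real.rpow_le_one hδ.le (by linarith) hβ
  have h5 : 2 * C * δ ^ β ≤ 2 * C := mul_le_of_le_one_right (by linarith) h4
  have h6 := abs_sub_abs_le_abs_sub (stratumFluctuation (clampExtend f) δ s u)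
    (derivWithin f (Set.Icc 0 1) s * (u - 1 / 2))
  linarith

theorem abs_integral_stratumFluctuation_sq_sub_le (hd : DifferentiableOn ℝ f (Set.Icc 0 1))
    (hC0 : 0 ≤ C) (hβ : 0 ≤ β)
    (hC : ∀ x ∈ Set.Icc (0 : ℝ) 1, ∀ y ∈ Set.Icc (0 : ℝ) 1,
      |derivWithin f (Set.Icc 0 1) x - derivWithin f (Set.Icc 0 1) y| ≤ C * |x - y| ^ β)
    (hM : ∀ x ∈ Set.Icc (0 : ℝ) 1, |derivWithin f (Set.Icc 0 1) x| ≤ M)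
    {s δ : ℝ} (hs : 0 ≤ s) (hδ : 0 < δ) (hsδ : s + δ ≤ 1) :
    |(∫ u in (0 : ℝ)..1, stratumFluctuation (clampExtend f) δ s u ^ 2) -
      derivWithin f (Set.Icc 0 1) s ^ 2 / 12| ≤ 2 * C * δ ^ β * (2 * (M + 2 * C)) := by
  have hF := continuous_clampExtend hd.continuousOn
  have hZ : Continuous fun u => stratumFluctuation (clampExtend f) δ s u ^ 2 :=
    (continuous_stratumFluctuation hF δ s).pow 2
  rw [← integral_linear_sq, ← intervalIntegral.integral_sub (hZ.intervalIntegrable _ _)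
    ((by fun_prop : Continuous fun u =>
      (derivWithin f (Set.Icc 0 1) s * (u - 1 / 2)) ^ 2).intervalIntegrable _ _)]
  refine abs_intervalIntegral_le fun u hu => ?_
  have h1 := abs_stratumFluctuation_sub_le hd hC0 hβ hC hs hδ hsδ hu
  have h2 := abs_stratumFluctuation_le hd hC0 hβ hC hM hs hδ hsδ hu
  have h3 : |derivWithin f (Set.Icc 0 1) s * (u - 1 / 2)| ≤ M + 2 * C := by
    rw [abs_mul]
    have h3 : |u - 1 / 2| ≤ 1 := by rw [abs_le]; constructor <;> linarith [hu.1, hu.2]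
    calc _ ≤ |derivWithin f (Set.Icc 0 1) s| * 1 := by gcongr
      _ ≤ M + 2 * C := by rw [mul_one]; linarith [hM s ⟨hs, by linarith⟩]
  rw [sq_sub_sq, abs_mul, mul_comm]
  gcongr
  refine (abs_add_le _ _).trans ?_
  linarith

theorem abs_sq_sub_blockAverage_le
    (hC0 : 0 ≤ C) (hβ : 0 ≤ β) {g : ℝ → ℝ} (hg : ContinuousOn g (Set.Icc 0 1))
    (hC : ∀ x ∈ Set.Icc (0 : ℝ) 1, ∀ y ∈ Set.Icc (0 : ℝ) 1, |g x - g y| ≤ C * |x - y| ^ β)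
    (hM : ∀ x ∈ Set.Icc (0 : ℝ) 1, |g x| ≤ M)
    {s δ : ℝ} (hs : 0 ≤ s) (hδ : 0 < δ) (hsδ : s + δ ≤ 1) :
    |g s ^ 2 - blockAverage (fun x => clampExtend g x ^ 2) δ s| ≤ C * δ ^ β * (2 * M) := by
  have hG := continuous_clampExtend hg
  have e : g s ^ 2 - blockAverage (fun x => clampExtend g x ^ 2) δ s =
      ∫ u in (0 : ℝ)..1, (g s ^ 2 - clampExtend g (s + δ * u) ^ 2) := by
    rw [intervalIntegral.integral_sub (by simp)
      ((by fun_prop : Continuous fun u => clampExtend g (s + δ * u) ^ 2).intervalIntegrable _ _)]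
    simp [blockAverage]
  rw [e]
  refine abs_intervalIntegral_le fun u hu => ?_
  have h1 : δ * u ≤ δ := mul_le_of_le_one_right hδ.le hu.2
  have h0 : 0 ≤ δ * u := mul_nonneg hδ.le hu.1
  have hmem : s + δ * u ∈ Set.Icc (0 : ℝ) 1 := ⟨by linarith, by linarith⟩
  have hsm : s ∈ Set.Icc (0 : ℝ) 1 := ⟨hs, by linarith⟩
  rw [clampExtend_of_mem g hmem, sq_sub_sq, abs_mul, mul_comm]
  have h2 : |g s - g (s + δ * u)| ≤ C * δ ^ β := by
    refine (hC s hsm _ hmem).trans ?_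
    gcongr
    rw [sub_add_cancel_left, abs_neg, abs_of_nonneg h0]
    exact h1
  have hM0 : 0 ≤ M := (abs_nonneg _).trans (hM s hsm)
  gcongr
  refine (abs_add_le _ _).trans ?_
  linarith [hM s hsm, hM _ hmem]

end Strata

/-! ### Asymptotic normality of one quadrature rule -/

section SingleEstimator

theorem average_blockAverage {𝕜 : Type*} [RCLike 𝕜] {g : ℝ → 𝕜} (hg : Continuous g) {N : ℕ}
    (hN : N ≠ 0) :
    (N : 𝕜)⁻¹ * ∑ j : Fin N, blockAverage g (N : ℝ)⁻¹ ((j : ℝ) / N) = ∫ x in (0 : ℝ)..1, g x := by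
  have hNR : (N : ℝ) ≠ 0 := by exact_mod_cast hN
  have h := inv_mul_sum_blockAverage hg hN (inv_ne_zero hNR) 0
  simp only [zero_add, ← div_eq_mul_inv] at h
  rw [h, div_self hNR, blockAverage]
  simp

theorem tendsto_average_variance {β : ℝ≥0} (hβ : 0 < β) {f : ℝ → ℝ}
    (hf : LipschitzDerivative β f) {K : ℕ → ℕ} (hK : Tendsto K atTop atTop) :
    Tendsto (fun n => (1 / (K n : ℝ)) * ∑ j : Fin (K n), ∫ u in (0 : ℝ)..1,
      stratumFluctuation (clampExtend f) (K n : ℝ)⁻¹ ((j : ℝ) / K n) u ^ 2) atTop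
      (𝓝 (sigmaSq f)) := by
  obtain ⟨C, M, hC0, hM0, hC, hM⟩ := hf.exists_bounds
  have hg := hf.continuousOn_derivWithin hβ
  set g := derivWithin f (Set.Icc 0 1) with hgdef
  have hG : Continuous fun x => clampExtend g x ^ 2 := (continuous_clampExtend hg).pow 2
  have hσ : sigmaSq f = (1 / 12) * ∫ x in (0 : ℝ)..1, clampExtend g x ^ 2 := by
    rw [sigmaSq]
    congr 1
    refine intervalIntegral.integral_congr fun x hx => ?_
    rw [Set.uIcc_of_le zero_le_one] at hx
    rw [clampExtend_of_mem g hx]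
  -- The first summand compares the stratum variance with `f'(s)²/12`, the second compares `f'(s)²`
  -- with its stratum average. The stratum averages themselves average exactly to the integral.
  set D : ℝ := 2 * C * (2 * (M + 2 * C)) + (1 / 12) * (C * (2 * M)) with hD
  have hz : Tendsto (fun n => D * ((K n : ℝ)⁻¹) ^ (β : ℝ)) atTop (𝓝 0) := by
    have h1 : Tendsto (fun n => (K n : ℝ)⁻¹) atTop (𝓝 0) :=
      (tendsto_natCast_atTop_atTop.comp hK).inv_tendsto_atTop
    have h2 := (h1.rpow_const (p := (β : ℝ)) (Or.inr β.2)).const_mul D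
    rwa [Real.zero_rpow (by exact_mod_cast hβ.ne'), mul_zero] at h2
  rw [tendsto_iff_norm_sub_tendsto_zero]
  refine squeeze_zero' (Eventually.of_forall fun _ => norm_nonneg _) ?_ hz
  filter_upwards [hK.eventually_gt_atTop 0] with n hn
  have hN : (0 : ℝ) < K n := by exact_mod_cast hn
  have hδ : (0 : ℝ) < (K n : ℝ)⁻¹ := inv_pos.2 hN
  rw [hσ, ← average_blockAverage hG hn.ne', Real.norm_eq_abs, one_div (K n : ℝ),
    mul_left_comm (1 / 12 : ℝ), ← mul_sub, Finset.mul_sum (a := (1 / 12 : ℝ)),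
    ← Finset.sum_sub_distrib, abs_mul, abs_of_pos hδ, inv_mul_le_iff₀ hN]
  refine (Finset.abs_sum_le_sum_abs _ _).trans ?_
  have hterm : ∀ j : Fin (K n), |(∫ u in (0 : ℝ)..1,
      stratumFluctuation (clampExtend f) (K n : ℝ)⁻¹ ((j : ℝ) / K n) u ^ 2) -
        1 / 12 * blockAverage (fun x => clampExtend g x ^ 2) (K n : ℝ)⁻¹ ((j : ℝ) / K n)| ≤
          D * ((K n : ℝ)⁻¹) ^ (β : ℝ) := fun j => by
    have hs : (0 : ℝ) ≤ (j : ℝ) / K n := by positivity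
    have hsδ : (j : ℝ) / K n + (K n : ℝ)⁻¹ ≤ 1 := by
      rw [← one_div, ← add_div, div_le_one hN]
      exact_mod_cast j.2
    have h1 := abs_integral_stratumFluctuation_sq_sub_le hf.1 hC0 β.coe_nonneg hC hM hs hδ hsδ
    have h2 := abs_sq_sub_blockAverage_le hC0 β.coe_nonneg hg hC hM hs hδ hsδ
    rw [← hgdef] at h1
    rw [hD]
    generalize ((K n : ℝ)⁻¹) ^ (β : ℝ) = ε at h1 h2 ⊢
    generalize blockAverage (fun x => clampExtend g x ^ 2) (K n : ℝ)⁻¹ ((j : ℝ) / K n) = B at h2 ⊢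
    rw [abs_le] at h1 h2 ⊢
    constructor
    · linarith [h1.1, h2.1]
    · linarith [h1.2, h2.2]
  refine (Finset.sum_le_sum fun j _ => hterm j).trans (le_of_eq ?_)
  simp

/-- The normalised quadrature error `N ^ (3/2) (Q_N - I)`. -/
noncomputable def scaledError (F : ℝ → ℝ) {N : ℕ} (x : Fin N → ℝ) : ℝ :=
  N * √(N : ℝ) * (quadrature F x - ∫ y in (0 : ℝ)..1, F y)

theorem measurable_scaledError {F : ℝ → ℝ} (hF : Continuous F) (N : ℕ) :
    Measurable fun x : Fin N → ℝ => scaledError F x := by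
  refine Continuous.measurable ?_
  unfold scaledError quadrature
  fun_prop

/-- The stratum means `A j` sum to `N I`, so the scaled error is `√N (∑ F(X i) - ∑ A j)`. The
centring constants are distributed over the strata only after the expectation has factorised, so it
does not matter which point lies in which stratum. -/
theorem integral_exp_scaledError {Ω : Type*} [MeasurableSpace Ω] {P : Measure Ω} {N : ℕ}
    (hN : N ≠ 0) {X : Fin N → Ω → ℝ} {F : ℝ → ℝ} (hF : Continuous F)
    (hX : ∀ g : ℝ → ℂ, Continuous g → (∀ x, ‖g x‖ ≤ 1) →
      ∫ ω, ∏ i, g (X i ω) ∂P = ∏ j : Fin N, blockAverage g (N : ℝ)⁻¹ ((j : ℝ) / N)) (t : ℝ) :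
    ∫ ω, Complex.exp (t * scaledError F (fun i => X i ω) * Complex.I) ∂P =
      ∏ j : Fin N, ∫ u, Complex.exp ((t / √(N : ℝ) *
        stratumFluctuation F (N : ℝ)⁻¹ ((j : ℝ) / N) u : ℝ) * Complex.I)
          ∂(volume.restrict (Set.Ioc (0 : ℝ) 1)) := by
  have hN0 : (0 : ℝ) < N := by exact_mod_cast Nat.pos_of_ne_zero hN
  have hs0 : (0 : ℝ) < √(N : ℝ) := Real.sqrt_pos.2 hN0
  set A : Fin N → ℝ := fun j => blockAverage F (N : ℝ)⁻¹ ((j : ℝ) / N) with hA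
  have hI : ∫ y in (0 : ℝ)..1, F y = (N : ℝ)⁻¹ * ∑ j, A j := (average_blockAverage hF hN).symm
  have hpoint : ∀ ω, Complex.exp (t * scaledError F (fun i => X i ω) * Complex.I) =
      (∏ j, Complex.exp ((-(t * √(N : ℝ) * A j) : ℝ) * Complex.I)) *
        ∏ i, Complex.exp ((t * √(N : ℝ) * F (X i ω) : ℝ) * Complex.I) := fun ω => by
    rw [← Complex.exp_sum, ← Complex.exp_sum, ← Complex.exp_add, ← Finset.sum_mul,
      ← Finset.sum_mul, ← add_mul, ← Complex.ofReal_sum, ← Complex.ofReal_sum,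
      ← Complex.ofReal_add, ← Complex.ofReal_mul]
    congr 3
    rw [scaledError, quadrature, hI, Finset.sum_neg_distrib, ← Finset.mul_sum, ← Finset.mul_sum]
    field_simp
    ring
  simp_rw [hpoint]
  rw [integral_const_mul, hX (fun x => Complex.exp ((t * √(N : ℝ) * F x : ℝ) * Complex.I))
    (by fun_prop) (fun x => by rw [Complex.norm_exp_ofReal_mul_I]), ← Finset.prod_mul_distrib]
  refine Finset.prod_congr rfl fun j _ => ?_
  rw [blockAverage, intervalIntegral.integral_of_le zero_le_one, ← integral_const_mul]
  refine integral_congr_ae (ae_of_all _ fun u => ?_)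
  simp only
  rw [← Complex.exp_add, ← add_mul, ← Complex.ofReal_add]
  congr 3
  rw [stratumFluctuation, inv_inv]
  have : t / √(N : ℝ) * N = t * √(N : ℝ) := by
    nth_rewrite 2 [← Real.mul_self_sqrt hN0.le]
    field_simp
  rw [← mul_assoc, this]
  ring

theorem tendsto_law_scaledError {β : ℝ≥0} (hβ : 0 < β) {f : ℝ → ℝ}
    (hf : LipschitzDerivative β f) {K : ℕ → ℕ} (hK : Tendsto K atTop atTop) (hK0 : ∀ n, K n ≠ 0)
    {Ω : ℕ → Type*} [∀ n, MeasurableSpace (Ω n)] (P : ∀ n, Measure (Ω n))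
    [∀ n, IsProbabilityMeasure (P n)] (X : ∀ n, Fin (K n) → Ω n → ℝ)
    (hX : ∀ n, ∀ g : ℝ → ℂ, Continuous g → (∀ x, ‖g x‖ ≤ 1) →
      ∫ ω, ∏ i, g (X n i ω) ∂P n =
        ∏ j : Fin (K n), blockAverage g (K n : ℝ)⁻¹ ((j : ℝ) / K n))
    (hm : ∀ n, AEMeasurable (fun ω => scaledError (clampExtend f) fun i => X n i ω) (P n)) :
    Tendsto (β := ProbabilityMeasure ℝ) (fun n =>
      ⟨(P n).map fun ω => scaledError (clampExtend f) fun i => X n i ω,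
        Measure.isProbabilityMeasure_map (hm n)⟩) atTop
      (𝓝 ⟨gaussianReal 0 (sigmaSq f).toNNReal, inferInstance⟩) := by
  have hF := continuous_clampExtend hf.1.continuousOn
  obtain ⟨C, M, hC0, hM0, hC, hM⟩ := hf.exists_bounds
  have hprob : IsProbabilityMeasure (volume.restrict (Set.Ioc (0 : ℝ) 1)) :=
    ⟨by simp⟩
  refine ProbabilityMeasure.tendsto_iff_tendsto_charFun.2 fun t => ?_
  simp only [ProbabilityMeasure.coe_mk, charFun_gaussianReal]
  have h1 : ∀ n, charFun ((P n).map fun ω => scaledError (clampExtend f) fun i => X n i ω) t =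
      ∏ j : Fin (K n), ∫ u, Complex.exp ((t / √(K n : ℝ) *
        stratumFluctuation (clampExtend f) (K n : ℝ)⁻¹ ((j : ℝ) / K n) u : ℝ) * Complex.I)
          ∂(volume.restrict (Set.Ioc (0 : ℝ) 1)) := fun n => by
    rw [← integral_exp_scaledError (hK0 n) hF (hX n), charFun_apply_real,
      integral_map (hm n) (by fun_prop)]
  simp_rw [h1]
  have hv : (0 : ℝ) ≤ sigmaSq f := by
    unfold sigmaSq
    exact mul_nonneg (by norm_num)
      (intervalIntegral.integral_nonneg zero_le_one fun x _ => sq_nonneg _)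
  have h2 := tendsto_prod_integral_exp hK (fun _ _ => volume.restrict (Set.Ioc (0 : ℝ) 1))
    (fun n j => stratumFluctuation (clampExtend f) (K n : ℝ)⁻¹ ((j : ℝ) / K n))
    (fun n j => (continuous_stratumFluctuation hF _ _).aestronglyMeasurable)
    (L := M + 2 * C) (by positivity)
    (fun n j => by
      have hN : (0 : ℝ) < K n := by exact_mod_cast Nat.pos_of_ne_zero (hK0 n)
      have hsδ : (j : ℝ) / K n + (K n : ℝ)⁻¹ ≤ 1 := by
        rw [← one_div, ← add_div, div_le_one hN]
        exact_mod_cast j.2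
      refine (ae_restrict_iff' measurableSet_Ioc).2 (ae_of_all _ fun u hu => ?_)
      exact abs_stratumFluctuation_le hf.1 hC0 β.coe_nonneg hC hM (by positivity) (inv_pos.2 hN) hsδ
        ⟨hu.1.le, hu.2⟩)
    (fun n j => by
      rw [← intervalIntegral.integral_of_le zero_le_one]
      exact integral_stratumFluctuation hF _ _)
    (v := sigmaSq f) (by
      simp_rw [← intervalIntegral.integral_of_le zero_le_one]
      exact tendsto_average_variance hβ hf hK) t
  convert! h2 using 2
  rw [Real.coe_toNNReal _ hv]
  congr 1
  push_cast
  ring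

end SingleEstimator

/-! ### The median of several quadrature rules -/

section MedianOfEstimators

theorem pi_gaussianReal_add_eq_zero {v : ℝ≥0} (hv : v ≠ 0) {r : ℕ} (i j : Fin r) :
    (Measure.pi fun _ : Fin r => gaussianReal 0 v) {w | w i + w j = 0} = 0 := by
  have := nullSingletonClass_gaussianReal (μ := 0) hv
  have heval : ∀ i : Fin r, (Measure.pi fun _ : Fin r => gaussianReal 0 v).map (fun w => w i) =
      gaussianReal 0 v := fun i => (measurePreserving_eval (fun _ : Fin r => gaussianReal 0 v) i).map_eq
  rcases eq_or_ne i j with rfl | hij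
  · have h : {w : Fin r → ℝ | w i + w i = 0} = {w | w i = 0} := by
      ext w
      simp only [Set.mem_ofPred_eq]
      constructor <;> intro h <;> linarith
    rw [h]
    exact Measure.pi_hyperplane _ i 0
  · have hind : iIndepFun (fun (i : Fin r) (w : Fin r → ℝ) => w i)
        (Measure.pi fun _ : Fin r => gaussianReal 0 v) :=
      iIndepFun_pi (X := fun _ x => x) fun _ => aemeasurable_id
    have hsum := gaussianReal_add_gaussianReal_of_indepFun (hind.indepFun hij)
      (heval i) (heval j)
    have hne : v + v ≠ 0 := by simpa using hv
    have h2 := nullSingletonClass_gaussianReal (μ := 0 + 0) hne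
    have h3 : (Measure.pi fun _ : Fin r => gaussianReal 0 v).map
        ((fun w : Fin r → ℝ => w i) + fun w : Fin r → ℝ => w j) {0} = 0 := by
      rw [hsum]
      exact measure_singleton 0
    rw [Measure.map_apply (by fun_prop) (measurableSet_singleton _)] at h3
    exact h3

/-- A zero median forces `w i + w j = 0` for some pair of indices, possibly equal; each such event
is null and there are finitely many. -/
theorem gaussianMedianLaw_singleton_zero {v : ℝ≥0} (hv : v ≠ 0) {r : ℕ} (hr : 0 < r) :
    (gaussianMedianLaw v r : Measure ℝ) {0} = 0 := by
  change ((Measure.pi fun _ : Fin r => gaussianReal 0 v).map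
    fun w => √(r : ℝ) * sampleMedian w) {0} = 0
  rw [Measure.map_apply (continuous_mul_sampleMedian _ _).measurable (measurableSet_singleton _)]
  refine measure_mono_null (t := ⋃ i : Fin r, ⋃ j : Fin r, {w : Fin r → ℝ | w i + w j = 0}) ?_ ?_
  · intro w hw
    have hs : √(r : ℝ) ≠ 0 := by positivity
    have h1 : sampleMedian w = 0 := by
      simpa [hs] using hw
    rw [sampleMedian_eq hr] at h1
    simp only [Set.mem_iUnion]
    exact ⟨_, _, (by simpa using h1 : orderStat w _ + orderStat w _ = 0)⟩
  · exact measure_iUnion_null fun i => measure_iUnion_null fun j =>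
      pi_gaussianReal_add_eq_zero hv i j

theorem medianEstimator_scaled_eq {f : ℝ → ℝ} {Ω : Type*} {r N : ℕ} (hr : 0 < r)
    (X : Fin r → Fin N → Ω → ℝ) {ω : Ω} (hω : ∀ j i, X j i ω ∈ Set.Icc (0 : ℝ) 1) :
    √(r : ℝ) * (N : ℝ) ^ (3 / 2 : ℝ) * (medianEstimator f X ω - exactIntegral f) =
      √(r : ℝ) * sampleMedian fun j => scaledError (clampExtend f) fun i => X j i ω := by
  have hI : ∫ y in (0 : ℝ)..1, clampExtend f y = exactIntegral f := by
    refine intervalIntegral.integral_congr fun x hx => ?_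
    rw [Set.uIcc_of_le zero_le_one] at hx
    exact clampExtend_of_mem f hx
  have hQ : ∀ j, quadrature (clampExtend f) (fun i => X j i ω) = quadrature f fun i => X j i ω :=
    fun j => by
      unfold quadrature
      simp_rw [clampExtend_of_mem f (hω j _)]
  have hpow : (N : ℝ) ^ (3 / 2 : ℝ) = N * √(N : ℝ) := by
    rw [Real.sqrt_eq_rpow, show (3 / 2 : ℝ) = 1 + 1 / 2 by norm_num,
      Real.rpow_add_of_nonneg (Nat.cast_nonneg _) (by norm_num) (by norm_num), Real.rpow_one]
  have h := sampleMedian_affine hr (fun j => quadrature f fun i => X j i ω)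
    (c := N * √(N : ℝ)) (by positivity) (-(N * √(N : ℝ) * exactIntegral f))
  have e : (fun j => scaledError (clampExtend f) fun i => X j i ω) = fun j =>
      N * √(N : ℝ) * quadrature f (fun i => X j i ω) + -(N * √(N : ℝ) * exactIntegral f) := by
    funext j
    rw [scaledError, hI, hQ]
    ring
  rw [e, h, hpow, medianEstimator]
  ring

/-- Convergence in law of the normalised median of `r` independent estimators. -/
theorem tendstoInDistribution_median {β : ℝ≥0} (hβ : 0 < β) {f : ℝ → ℝ}
    (hf : LipschitzDerivative β f) {K : ℕ → ℕ} (hK : Tendsto K atTop atTop) (hK0 : ∀ n, K n ≠ 0)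
    {r : ℕ} (hr : 0 < r) {Ω : ℕ → Type*} [∀ n, MeasurableSpace (Ω n)] (P : ∀ n, Measure (Ω n))
    [∀ n, IsProbabilityMeasure (P n)] (X : ∀ n, Fin r → Fin (K n) → Ω n → ℝ)
    (hXm : ∀ n j i, AEMeasurable (X n j i) (P n))
    (hX01 : ∀ n j i, ∀ᵐ ω ∂P n, X n j i ω ∈ Set.Icc (0 : ℝ) 1)
    (hX : ∀ n j, ∀ g : ℝ → ℂ, Continuous g → (∀ x, ‖g x‖ ≤ 1) →
      ∫ ω, ∏ i, g (X n j i ω) ∂P n =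
        ∏ k : Fin (K n), blockAverage g (K n : ℝ)⁻¹ ((k : ℝ) / K n))
    (hind : ∀ n, iIndepFun (fun (j : Fin r) (ω : Ω n) (i : Fin (K n)) => X n j i ω) (P n)) :
    TendstoInDistribution
      (fun n ω => √(r : ℝ) * (K n : ℝ) ^ (3 / 2 : ℝ) *
        (medianEstimator f (X n) ω - exactIntegral f))
      atTop (id : ℝ → ℝ) P (gaussianMedianLaw (sigmaSq f).toNNReal r : Measure ℝ) := by
  have hF := continuous_clampExtend hf.1.continuousOn
  let V : ∀ n, Fin r → Ω n → ℝ := fun n j ω => scaledError (clampExtend f) fun i => X n j i ω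
  have hVm : ∀ n j, AEMeasurable (V n j) (P n) := fun n j =>
    (measurable_scaledError hF (K n)).comp_aemeasurable (aemeasurable_pi_lambda _ (hXm n j))
  have hVind : ∀ n, iIndepFun (V n) (P n) := fun n =>
    (hind n).comp (fun _ x => scaledError (clampExtend f) x) fun _ => measurable_scaledError hF _
  have hVvm : ∀ n, AEMeasurable (fun ω j => V n j ω) (P n) := fun n =>
    aemeasurable_pi_lambda _ (hVm n)
  have hmarg : ∀ j, Tendsto (β := ProbabilityMeasure ℝ) (fun n => ⟨(P n).map (V n j),
      Measure.isProbabilityMeasure_map (hVm n j)⟩) atTop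
        (𝓝 ⟨gaussianReal 0 (sigmaSq f).toNNReal, inferInstance⟩) := fun j =>
    tendsto_law_scaledError hβ hf hK hK0 P (fun n => X n j) (fun n => hX n j) fun n => hVm n j
  -- Weak convergence of the marginals passes to the product measures, which are the joint laws by
  -- independence; the continuous mapping theorem then yields the median.
  have hjoint := (ProbabilityMeasure.continuous_pi.tendsto _).comp (tendsto_pi_nhds.2 hmarg)
  have hmed := ProbabilityMeasure.tendsto_map_of_tendsto_of_continuous _ _ hjoint
    (continuous_mul_sampleMedian (√(r : ℝ)) r)
  have hW : TendstoInDistribution (fun n ω => √(r : ℝ) * sampleMedian fun j => V n j ω) atTop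
      (id : ℝ → ℝ) P (gaussianMedianLaw (sigmaSq f).toNNReal r : Measure ℝ) := by
    refine ⟨fun n => (continuous_mul_sampleMedian _ _).measurable.comp_aemeasurable (hVvm n),
      aemeasurable_id, ?_⟩
    have hlaw : ∀ n, (P n).map (fun ω => √(r : ℝ) * sampleMedian fun j => V n j ω) =
        (Measure.pi fun j => (P n).map (V n j)).map fun w => √(r : ℝ) * sampleMedian w := fun n => by
      rw [← (iIndepFun_iff_map_fun_eq_pi_map (hVm n)).1 (hVind n),
        AEMeasurable.map_map_of_aemeasurable
          (continuous_mul_sampleMedian _ _).measurable.aemeasurable (hVvm n)]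
      rfl
    have hlim : (⟨(gaussianMedianLaw (sigmaSq f).toNNReal r : Measure ℝ).map id,
        Measure.isProbabilityMeasure_map aemeasurable_id⟩ : ProbabilityMeasure ℝ) =
          gaussianMedianLaw (sigmaSq f).toNNReal r := Subtype.ext Measure.map_id
    rw [hlim]
    exact hmed.congr fun n => Subtype.ext (hlaw n).symm
  refine hW.congr (fun n => ?_) (EventuallyEq.refl _ _)
  have hall : ∀ᵐ ω ∂P n, ∀ j i, X n j i ω ∈ Set.Icc (0 : ℝ) 1 :=
    ae_all_iff.2 fun j => ae_all_iff.2 fun i => hX01 n j i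
  filter_upwards [hall] with ω hω
  exact (medianEstimator_scaled_eq hr (X n) hω).symm

/-- If the limit law has no atom at `0`, the variables are eventually outside any shrinking
neighbourhood of `0`. -/
theorem tendsto_measure_abs_gt {Ω : ℕ → Type*} [∀ n, MeasurableSpace (Ω n)]
    {P : ∀ n, Measure (Ω n)} [∀ n, IsProbabilityMeasure (P n)] {W : ∀ n, Ω n → ℝ}
    {ν : ProbabilityMeasure ℝ}
    (hW : TendstoInDistribution W atTop (id : ℝ → ℝ) P (ν : Measure ℝ))
    (hν : (ν : Measure ℝ) {0} = 0) {η : ℕ → ℝ} (hη : Tendsto η atTop (𝓝 0)) :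
    Tendsto (fun n => P n {ω | η n < |W n ω|}) atTop (𝓝 1) := by
  have hopen : ∀ ε : ℝ, IsOpen {x : ℝ | ε < |x|} := fun ε =>
    isOpen_lt continuous_const continuous_abs
  have hexh : Tendsto (fun k : ℕ => (ν : Measure ℝ) {x : ℝ | 1 / ((k : ℝ) + 1) < |x|}) atTop
      (𝓝 1) := by
    have hmono : Monotone fun k : ℕ => {x : ℝ | 1 / ((k : ℝ) + 1) < |x|} := fun k l hkl x hx =>
      by
      have h1 : 1 / ((l : ℝ) + 1) ≤ 1 / ((k : ℝ) + 1) := by gcongr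
      exact h1.trans_lt hx
    have hU : ⋃ k : ℕ, {x : ℝ | 1 / ((k : ℝ) + 1) < |x|} = {0}ᶜ := by
      ext x
      simp only [Set.mem_iUnion, Set.mem_ofPred_eq, Set.mem_compl_iff, Set.mem_singleton_iff]
      constructor
      · rintro ⟨k, hk⟩ rfl
        rw [abs_zero] at hk
        have : (0 : ℝ) < 1 / ((k : ℝ) + 1) := by positivity
        linarith
      · exact fun hx => exists_nat_one_div_lt (abs_pos.2 hx)
    have h := tendsto_measure_iUnion_atTop (μ := (ν : Measure ℝ)) hmono
    rwa [hU, (prob_compl_eq_one_iff (measurableSet_singleton 0)).2 hν] at h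
  refine tendsto_order.2 ⟨fun a ha => ?_, fun a ha => Eventually.of_forall fun n =>
    prob_le_one.trans_lt ha⟩
  -- Fix a threshold `1/(k+1)` beyond which the limit law has mass above `a`. The portmanteau
  -- inequality for open sets transfers this to `W n`, and `η n` eventually falls below the
  -- threshold.
  obtain ⟨k, hk⟩ := ((tendsto_order.1 hexh).1 a ha).exists
  have hlim := ProbabilityMeasure.le_liminf_measure_open_of_tendsto hW.tendsto
    (hopen (1 / ((k : ℝ) + 1)))
  have hmap : ∀ n, ((P n).map (W n)) {x : ℝ | 1 / ((k : ℝ) + 1) < |x|} =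
      P n {ω | 1 / ((k : ℝ) + 1) < |W n ω|} := fun n => by
    rw [Measure.map_apply_of_aemeasurable (hW.forall_aemeasurable n) (hopen _).measurableSet]
    rfl
  simp only [ProbabilityMeasure.coe_mk, Measure.map_id, hmap] at hlim
  have hev := eventually_lt_of_lt_liminf (hk.trans_le hlim)
  filter_upwards [hev, (tendsto_order.1 hη).2 (1 / ((k : ℝ) + 1)) (by positivity)] with n hn hn2
  exact hn.trans_le (measure_mono fun ω hω => hn2.trans hω)

end MedianOfEstimators

end MedianRQMC

/-! ### The main theorem -/

theorem theorem1 (b : ℕ) [NeZero b] (hb : 2 ≤ b) (β : ℝ≥0) (hβ : 0 < β) (f : ℝ → ℝ)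
    (hf : MedianRQMC.LipschitzDerivative β f)
    -- for every `m` and `r`, a probability space carrying `r` independent sets of `b ^ m` nodes
    {Ω : ℕ → ℕ → Type*} [∀ m r, MeasurableSpace (Ω m r)]
    (P : ∀ m r, Measure (Ω m r)) [∀ m r, IsProbabilityMeasure (P m r)]
    (X : ∀ m r, Fin r → Fin (b ^ m) → Ω m r → ℝ)
    (hX : (∀ m r j, MedianRQMC.IsNestedScrambledNet (P m r) b m (X m r j)) ∨
      (∀ m r j, MedianRQMC.IsJitteredSample (P m r) (X m r j)))
    (hind : ∀ m r, iIndepFun (fun (j : Fin r) (ω : Ω m r) (i : Fin (b ^ m)) => X m r j i ω)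
      (P m r)) :
    -- convergence in law, first as `m → ∞` for each fixed `r`, then as `r → ∞`
    (∃ ν : ℕ → ProbabilityMeasure ℝ,
      (∀ r : ℕ, 1 ≤ r →
        TendstoInDistribution
          (fun m ω => √(r : ℝ) * ((b : ℝ) ^ m) ^ (3 / 2 : ℝ) *
            (MedianRQMC.medianEstimator f (X m r) ω - MedianRQMC.exactIntegral f))
          atTop (id : ℝ → ℝ) (fun m => P m r) (ν r : Measure ℝ)) ∧
      Tendsto ν atTop (𝓝
        (⟨gaussianReal 0 (Real.toNNReal (Real.pi * MedianRQMC.sigmaSq f / 2)),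
          inferInstance⟩ : ProbabilityMeasure ℝ))) ∧
    -- for fixed `r`, the error is of no smaller order than `N ^ (-3/2)`, with probability tending to 1
    (0 < MedianRQMC.sigmaSq f → ∀ r : ℕ, 1 ≤ r → ∀ δ : ℕ → ℝ, Tendsto δ atTop (𝓝 0) →
      Tendsto
        (fun m => P m r {ω | δ m * ((b : ℝ) ^ m) ^ (-(3 / 2) : ℝ) <
          |MedianRQMC.medianEstimator f (X m r) ω - MedianRQMC.exactIntegral f|})
        atTop (𝓝 1)) := by
  -- Measurability, range in `[0,1]` and the product formula are all that is needed of a set of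
  -- nodes; from here on the two schemes are treated together.
  obtain ⟨hXm, hX01, hXprod⟩ : (∀ m r j i, AEMeasurable (X m r j i) (P m r)) ∧
      (∀ m r j i, ∀ᵐ ω ∂P m r, X m r j i ω ∈ Set.Icc (0 : ℝ) 1) ∧
      ∀ m r j, ∀ g : ℝ → ℂ, Continuous g → (∀ x, ‖g x‖ ≤ 1) →
        ∫ ω, ∏ i, g (X m r j i ω) ∂P m r = ∏ k : Fin (b ^ m),
          MedianRQMC.blockAverage g ((b ^ m : ℕ) : ℝ)⁻¹ ((k : ℝ) / ((b ^ m : ℕ) : ℝ)) := by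
    rcases hX with h | h
    · refine ⟨fun m r j i => ((h m r j).measurable i).aemeasurable,
        fun m r j i => ae_of_all _ ((h m r j).mem i), fun m r j g hg hg1 => ?_⟩
      rw [(h m r j).integral_prod hb hg hg1]
      push_cast
      rfl
    · refine ⟨fun m r j i => (h m r j).aemeasurable i, fun m r j i => (h m r j).ae_mem i,
        fun m r j g hg hg1 => ?_⟩
      rw [(h m r j).integral_prod hg]
      simp_rw [one_div]
  have hK : Tendsto (fun m => b ^ m) atTop atTop := tendsto_pow_atTop_atTop_of_one_lt hb
  have hK0 : ∀ m, b ^ m ≠ 0 := fun m => pow_ne_zero m (NeZero.ne b)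
  have hσ : 0 ≤ MedianRQMC.sigmaSq f :=
    mul_nonneg (by norm_num)
      (intervalIntegral.integral_nonneg zero_le_one fun x _ => sq_nonneg _)
  have hlaw : ∀ r : ℕ, 1 ≤ r → TendstoInDistribution
      (fun m ω => √(r : ℝ) * ((b : ℝ) ^ m) ^ (3 / 2 : ℝ) *
        (MedianRQMC.medianEstimator f (X m r) ω - MedianRQMC.exactIntegral f))
      atTop (id : ℝ → ℝ) (fun m => P m r)
      (MedianRQMC.gaussianMedianLaw (MedianRQMC.sigmaSq f).toNNReal r : Measure ℝ) :=
    fun r hr => by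
      have h := MedianRQMC.tendstoInDistribution_median hβ hf hK hK0 hr (fun m => P m r)
        (fun m => X m r) (fun m => hXm m r) (fun m => hX01 m r) (fun m => hXprod m r)
        fun m => hind m r
      simpa only [Nat.cast_pow] using h
  refine ⟨⟨MedianRQMC.gaussianMedianLaw (MedianRQMC.sigmaSq f).toNNReal, hlaw, ?_⟩, ?_⟩
  · have h := MedianRQMC.tendsto_gaussianMedianLaw (MedianRQMC.sigmaSq f).toNNReal
    rwa [Real.coe_toNNReal _ hσ] at h
  · intro hpos r hr δ hδ
    have h0 := MedianRQMC.gaussianMedianLaw_singleton_zero (Real.toNNReal_pos.2 hpos).ne' hr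
    -- Multiplying the event by `√r N^(3/2)` expresses it through the normalised median, with
    -- threshold `√r δ m`.
    have hη : Tendsto (fun m => √(r : ℝ) * δ m) atTop (𝓝 0) := by
      simpa using hδ.const_mul √(r : ℝ)
    refine (MedianRQMC.tendsto_measure_abs_gt (hlaw r hr) h0 hη).congr fun m => ?_
    congr 1
    ext ω
    have hbpos : (0 : ℝ) < b := by exact_mod_cast NeZero.pos b
    have hs : 0 < √(r : ℝ) := by positivity
    have hN : 0 < ((b : ℝ) ^ m) ^ (3 / 2 : ℝ) := by positivity
    simp only [Set.mem_ofPred_eq]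
    rw [abs_mul, abs_of_pos (mul_pos hs hN), mul_assoc, mul_lt_mul_iff_right₀ hs,
      Real.rpow_neg (by positivity), ← div_eq_mul_inv, div_lt_iff₀' hN]
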